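/- Let $A=\mathbb R\langle X,Y\rangle/(X^2,Y^2)$, let $\mathfrak{wsl}_2^{\mathrm{alg}}\subset A$ be the Lie subalgebra generated by $X,Y$, and put $X^{(2n+1)}=(XY)^nX$, $Y^{(2m+1)}=(YX)^mY$ ($n,m\ge 0$) and $XY^{(2k)}=(XY)^k-(YX)^k$ ($k\ge1$). In an associative algebra let $\mathrm{BCH}(a,b)=\log(\exp a\exp b)$ denote the formal series, with bihomogeneous parts $\mathrm{BCH}_{p,q}(a,b)$ and homogeneous parts $\mathrm{BCH}_n=\sum_{p+q=n}\mathrm{BCH}_{p,q}$. Let $\kappa_k=(k!)^2/(2k+1)!$. For $p,q\ge0$ let $\Gamma^{\mathrm{Lie}}_{p,q}\in[0,\infty]$ be the infimum of $\sum_\gamma|\theta_\gamma|$ over all presentations $\mathrm{BCH}_{p,q}(Y_1,Y_2)=\sum_\gamma\theta_\gamma\gamma(Y_1,Y_2)$ as a finite real linear combination of Lie monomials $\gamma$ in free variables $Y_1,Y_2$. For $x,y\ge0$ put $\Gamma^{\mathrm{Lie}}(x,y)=\sum_{p,q}\Gamma^{\mathrm{Lie}}_{p,q}x^py^q\in[0,\infty]$,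 and let $$\mathrm C_2^{\mathrm{Lie}}=\sup\Bigl\{x\ge0:\sup_{x_1,x_2\ge0,\ x_1+x_2\le x}\Gamma^{\mathrm{Lie}}(x_1,x_2)<\infty\Bigr\},\qquad \mathrm D_2^{\mathrm{Lie}}=\sup\Bigl\{x\ge0:\Gamma^{\mathrm{Lie}}\bigl(\tfrac x2,\tfrac x2\bigr)<\infty\Bigr\}.$$ (1) The elements $X^{(2n+1)}$, $Y^{(2m+1)}$ ($n,m\ge 0$), $XY^{(2k)}$ ($k\ge 1$) form a linear basis of $\mathfrak{wsl}_2^{\mathrm{alg}}$, and $[X^{(2n+1)},Y^{(2m+1)}]=XY^{(2n+2m+2)}$, $[XY^{(2k)},X^{(2n+1)}]=2X^{(2k+2n+1)}$, $[Y^{(2m+1)},XY^{(2k)}]=2Y^{(2k+2m+1)}$, all other brackets of basis elements (up to order) being $0$. The completion $\mathfrak{wsl}_2^1$ of $\mathfrak{wsl}_2^{\mathrm{alg}}$ with respect to the norm $$\Bigl\|\sum_n b_nX^{(2n+1)}+\sum_m c_mY^{(2m+1)}+\sum_{k\ge1} d_kXY^{(2k)}\Bigr\|=\sum_n|b_n|2^{-n}+\sum_m|c_m|2^{-m}+\sum_{k\ge1}|d_k|2^{-k+1}$$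 is a Banach–Lie algebra, i.e. $\|[z,w]\|\le\|z\|\,\|w\|$; and $\|X\|=\|Y\|=1$. (2) For every real $t$, formally, $$\mathrm{BCH}(tX,tY)=\sum_{k\ge0}(-1)^k\kappa_k\Bigl(t^{2k+1}X^{(2k+1)}+t^{2k+1}Y^{(2k+1)}+\tfrac12t^{2k+2}XY^{(2k+2)}\Bigr),$$ and the value at $(tX,tY)$ of any Lie polynomial presenting $\mathrm{BCH}_n$ is the degree $n$ part of this series. The series $\sum_n\mathrm{BCH}_n(tX,tY)$ converges absolutely in $\mathfrak{wsl}_2^1$ if $|t|<2\sqrt2$, and its partial sums diverge in $\mathfrak{wsl}_2^1$ if $|t|\ge2\sqrt2$, in particular at $t=2\sqrt2$. Moreover no $z\in\mathfrak{wsl}_2^1$ satisfies $\exp z=\exp(2\sqrt2X)\exp(2\sqrt2Y)$ as formal series graded by degree in $X,Y$ with coefficients in $A$. (3) For $a,b,c\in\mathbb R$ let $S(a,b,c)=\begin{bmatrix}a&\sqrt2b\\\sqrt2c&-a\end{bmatrix}$. With the norm $\|S(a,b,c)\|=2\sqrt{a^2+b^2+c^2}$, $\mathfrak{sl}_2(\mathbb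 R)$ is a Banach–Lie algebra. The matrices $\hat X=\begin{bmatrix}0&\sqrt2/2\\0&0\end{bmatrix}$ and $\hat Y=\begin{bmatrix}0&0\\\sqrt2/2&0\end{bmatrix}$ have norm $1$, and $X\mapsto\hat X$, $Y\mapsto\hat Y$ extends to an algebra homomorphism from $A$ to the $2\times2$ matrices. For every real $t$, formally, $$\mathrm{BCH}(t\hat X,t\hat Y)=\sum_{k\ge0}(-1)^k\kappa_k2^{-k}\left(t^{2k+1}\begin{bmatrix}0&\sqrt2/2\\\sqrt2/2&0\end{bmatrix}+t^{2k+2}\begin{bmatrix}1/4&0\\0&-1/4\end{bmatrix}\right).$$ If $|t|<2\sqrt2$, the sum of this series is $$L(t)=\frac{2\operatorname{arsinh}(2^{-3/2}t)}{\sqrt{8+t^2}}\begin{bmatrix}t&2\sqrt2\\2\sqrt2&-t\end{bmatrix}.$$ The series $\sum_n\mathrm{BCH}_n(t\hat X,t\hat Y)$ does not converge absolutely if $|t|\ge2\sqrt2$, and its partial sums diverge if $|t|>2\sqrt2$; nevertheless $\exp L(t)=\exp(t\hat X)\exp(t\hat Y)$ for all real $t$. (4) Let $\Xi(t)=\sum_{k\ge0}\kappa_k\bigl(2^{1-k}t^{2k+1}+2^{-k-1}t^{2k+2}\bigr)$.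 Then $\Gamma^{\mathrm{Lie}}(t,t)\ge\Xi(t)$ coefficientwise in $t$; for $0\le t<2\sqrt2$ the series converges with $$\Xi(t)=\frac{4\arcsin(2^{-3/2}t)}{\sqrt{8-t^2}}(4+t),$$ and for $t\ge2\sqrt2$ it diverges. (5) Consequently $\Gamma^{\mathrm{Lie}}(2\sqrt2,2\sqrt2)=+\infty$ and $\mathrm C_2^{\mathrm{Lie}}\le\mathrm D_2^{\mathrm{Lie}}\le4\sqrt2$. -/

import Mathlib

open Filter Topology
open scoped NNReal ENNReal

attribute [local instance 100] LieRing.ofAssociativeRing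

noncomputable section

namespace LieBCH

/-! ## Formal exponential and logarithm, and the BCH series in an associative algebra

Elements of a (noncommutative) real algebra `A` are multiplied by commuting bookkeeping variables,
so that formal series graded by degree are elements of `MvPowerSeries σ A`. -/

section Formal

variable {A : Type*} [Ring A] [Algebra ℝ A] {σ : Type*}

/-- The formal exponential `∑ₖ fᵏ / k!` of a series `f` without constant term (for such `f` the power
`fᵏ` has no terms of degree less than `k`, so in each degree the sum is finite). -/
def formalExp (f : MvPowerSeries σ A) : MvPowerSeries σ A := fun d =>
  ∑ k ∈ Finset.range (d.degree + 1), ((k.factorial : ℝ)⁻¹) • MvPowerSeries.coeff d (f ^ k)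

/-- The formal logarithm `∑ₖ (-1)^(k+1) (g - 1)ᵏ / k` of a series `g` with constant term `1`. -/
def formalLog (g : MvPowerSeries σ A) : MvPowerSeries σ A := fun d =>
  ∑ k ∈ Finset.Icc 1 d.degree, ((-1 : ℝ) ^ (k + 1) / k) • MvPowerSeries.coeff d ((g - 1) ^ k)

/-- `BCH(a, b) = log (exp a exp b)`, graded by the number of factors `a` (variable `0`) and the number
of factors `b` (variable `1`). -/
def bchSeries (a b : A) : MvPowerSeries (Fin 2) A :=
  formalLog (formalExp (MvPowerSeries.monomial (Finsupp.single 0 1) a) *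
    formalExp (MvPowerSeries.monomial (Finsupp.single 1 1) b))

/-- The part of `BCH(a, b)` of degree `p` in `a` and of degree `q` in `b`. -/
def bchPart (p q : ℕ) (a b : A) : A :=
  MvPowerSeries.coeff (Finsupp.single 0 p + Finsupp.single 1 q) (bchSeries a b)

/-- The homogeneous part of `BCH(a, b)` of total degree `n`. -/
def bchTerm (n : ℕ) (a b : A) : A :=
  ∑ pq ∈ Finset.HasAntidiagonal.antidiagonal n, bchPart pq.1 pq.2 a b

end Formal

/-! ## The `ℓ¹` Lie norm, the series `Γ^Lie` and the convergence radii -/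

/-- The Lie monomial in the elements `v i` with a given bracketing. -/
def lieMonomial {α L : Type*} [LieRing L] (v : α → L) : FreeMagma α → L
  | FreeMagma.of i => v i
  | FreeMagma.mul γ δ => ⁅lieMonomial v γ, lieMonomial v δ⁆

/-- The `ℓ¹` norm on the free Lie algebra on two generators, realised as the Lie subalgebra of the
free associative algebra generated by the variables: the infimum of the sums of the absolute values of
the coefficients over all presentations by Lie monomials (`∞` for elements that are not Lie
polynomials). -/
def lieL1Norm (P : FreeAlgebra ℝ (Fin 2)) : ℝ≥0∞ :=
  ⨅ (θ : FreeMagma (Fin 2) →₀ ℝ)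
    (_ : θ.sum (fun γ c => c • lieMonomial (FreeAlgebra.ι ℝ) γ) = P),
    ENNReal.ofReal (θ.sum fun _ c => |c|)

/-- The coefficient `Γ^Lie_{p,q}`: the `ℓ¹` Lie norm of the bihomogeneous part of the BCH series in two
free variables. -/
def gammaCoeff (p q : ℕ) : ℝ≥0∞ :=
  lieL1Norm (bchPart p q (FreeAlgebra.ι ℝ (0 : Fin 2)) (FreeAlgebra.ι ℝ (1 : Fin 2)))

/-- The value in `[0, ∞]` of the power series `Γ^Lie` at `x, y ≥ 0`. -/
def gammaLie (x y : ℝ≥0) : ℝ≥0∞ :=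
  ∑' (p : ℕ) (q : ℕ), gammaCoeff p q * (x : ℝ≥0∞) ^ p * (y : ℝ≥0∞) ^ q

/-- The cumulative convergence radius `C₂^Lie`. -/
def cumulativeRadius : ℝ≥0∞ :=
  ⨆ (x : ℝ≥0) (_ : (⨆ (x₁ : ℝ≥0) (x₂ : ℝ≥0) (_ : x₁ + x₂ ≤ x), gammaLie x₁ x₂) < ∞), (x : ℝ≥0∞)

/-- The diagonal convergence radius `D₂^Lie`. -/
def diagonalRadius : ℝ≥0∞ :=
  ⨆ (x : ℝ≥0) (_ : gammaLie (x / 2) (x / 2) < ∞), (x : ℝ≥0∞)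

/-- The coefficient `(k!)² / (2k+1)!`. -/
def kappa (k : ℕ) : ℝ := ((k.factorial : ℝ) ^ 2) / ((2 * k + 1).factorial : ℝ)

/-! ## The algebra with `X² = Y² = 0` and its Lie subalgebra -/

/-- The relations `X² = 0` and `Y² = 0`. -/
inductive SqZeroRel : FreeAlgebra ℝ (Fin 2) → FreeAlgebra ℝ (Fin 2) → Prop
  | sq (i : Fin 2) : SqZeroRel (FreeAlgebra.ι ℝ i * FreeAlgebra.ι ℝ i) 0

/-- The noncommutative polynomial algebra in `X, Y` modulo `X² = Y² = 0`. -/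
abbrev SqZeroAlg : Type := RingQuot SqZeroRel

/-- The generator `X`. -/
def genX : SqZeroAlg := RingQuot.mkAlgHom ℝ SqZeroRel (FreeAlgebra.ι ℝ 0)

/-- The generator `Y`. -/
def genY : SqZeroAlg := RingQuot.mkAlgHom ℝ SqZeroRel (FreeAlgebra.ι ℝ 1)

/-- `X^{(2n+1)} = (XY)ⁿX`. -/
def oddX (n : ℕ) : SqZeroAlg := (genX * genY) ^ n * genX

/-- `Y^{(2m+1)} = (YX)ᵐY`. -/
def oddY (m : ℕ) : SqZeroAlg := (genY * genX) ^ m * genY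

/-- `XY^{(2k)} = (XY)ᵏ - (YX)ᵏ`, used for `k ≥ 1`. -/
def evenXY (k : ℕ) : SqZeroAlg := (genX * genY) ^ k - (genY * genX) ^ k

/-- The Lie algebra `wsl₂^alg`, generated by `X` and `Y`. -/
def wslAlg : LieSubalgebra ℝ SqZeroAlg := LieSubalgebra.lieSpan ℝ SqZeroAlg {genX, genY}

/-- `X` as an element of `wsl₂^alg`. -/
def wslX : wslAlg := ⟨genX, LieSubalgebra.subset_lieSpan (by simp)⟩

/-- `Y` as an element of `wsl₂^alg`. -/
def wslY : wslAlg := ⟨genY, LieSubalgebra.subset_lieSpan (by simp)⟩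

/-- The family `X^{(2n+1)}` (`n ≥ 0`), `Y^{(2m+1)}` (`m ≥ 0`), `XY^{(2k+2)}` (`k ≥ 0`). -/
def wslVec : ℕ ⊕ ℕ ⊕ ℕ → SqZeroAlg :=
  Sum.elim oddX (Sum.elim oddY fun k => evenXY (k + 1))

/-! ## The Banach–Lie algebra `wsl₂¹` -/

/-- The coefficient sequence of `f` is summable with weights `2⁻ⁿ`. -/
def WSummable (f : PowerSeries ℝ) : Prop :=
  Summable fun n : ℕ => (1 / 2 : ℝ) ^ n * |PowerSeries.coeff n f|

/-- The weighted `ℓ¹` norm `∑ₙ 2⁻ⁿ |fₙ|`. -/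
def wNorm (f : PowerSeries ℝ) : ℝ := ∑' n : ℕ, (1 / 2 : ℝ) ^ n * |PowerSeries.coeff n f|

theorem WSummable.zero : WSummable 0 := by
  simp [WSummable, summable_zero]

theorem WSummable.add {f g : PowerSeries ℝ} (hf : WSummable f) (hg : WSummable g) :
    WSummable (f + g) := by
  refine Summable.of_nonneg_of_le (fun n => by positivity) (fun n => ?_) (Summable.add hf hg)
  rw [map_add, ← mul_add]
  exact mul_le_mul_of_nonneg_left (abs_add_le _ _) (by positivity)

theorem WSummable.smul {f : PowerSeries ℝ} (c : ℝ) (hf : WSummable f) : WSummable (c • f) := by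
  have h := Summable.mul_left |c| hf
  refine h.congr fun n => ?_
  rw [map_smul, smul_eq_mul, abs_mul]
  ring

theorem WSummable.sub {f g : PowerSeries ℝ} (hf : WSummable f) (hg : WSummable g) :
    WSummable (f - g) := by
  have h := hf.add (hg.smul (-1))
  rwa [neg_one_smul, ← sub_eq_add_neg] at h

theorem WSummable.mul {f g : PowerSeries ℝ} (hf : WSummable f) (hg : WSummable g) :
    WSummable (f * g) := by
  have key : ∀ h : PowerSeries ℝ,
      WSummable h ↔ Summable fun n : ℕ => ‖(1 / 2 : ℝ) ^ n * PowerSeries.coeff n h‖ := by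
    intro h
    refine summable_congr fun n => ?_
    rw [norm_mul, Real.norm_eq_abs (PowerSeries.coeff n h), Real.norm_of_nonneg (by positivity)]
  rw [key] at hf hg ⊢
  refine (summable_norm_sum_mul_antidiagonal_of_summable_norm hf hg).congr fun n => ?_
  rw [PowerSeries.coeff_mul, Finset.mul_sum]
  congr 1
  refine Finset.sum_congr rfl fun pq hpq => ?_
  rw [← Finset.HasAntidiagonal.mem_antidiagonal.1 hpq, pow_add]
  ring

theorem WSummable.X : WSummable (PowerSeries.X : PowerSeries ℝ) := by
  refine summable_of_ne_finset_zero (s := {1}) fun n hn => ?_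
  rw [PowerSeries.coeff_X, if_neg (by simpa using hn)]
  simp

/-- Triples of sequences `(b, c, d)`, written as power series, that are summable with the weights. -/
def wslSubmodule : Submodule ℝ (PowerSeries ℝ × PowerSeries ℝ × PowerSeries ℝ) where
  carrier := {z | WSummable z.1 ∧ WSummable z.2.1 ∧ WSummable z.2.2}
  zero_mem' := ⟨WSummable.zero, WSummable.zero, WSummable.zero⟩
  add_mem' := fun ha hb => ⟨ha.1.add hb.1, ha.2.1.add hb.2.1, ha.2.2.add hb.2.2⟩
  smul_mem' := fun c _ ha => ⟨ha.1.smul c, ha.2.1.smul c, ha.2.2.smul c⟩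

/-- The space `wsl₂¹`. The triple `(b, c, d)` stands for the infinite sum
`∑ₙ bₙ X^{(2n+1)} + ∑ₘ cₘ Y^{(2m+1)} + ∑ₖ dₖ XY^{(2k+2)}` (`n, m, k ≥ 0`). -/
def Wsl : Type := ↥wslSubmodule

instance : AddCommGroup Wsl := inferInstanceAs (AddCommGroup ↥wslSubmodule)
instance : Module ℝ Wsl := inferInstanceAs (Module ℝ ↥wslSubmodule)

/-- The triple of coefficient sequences of an element of `wsl₂¹`. -/
def Wsl.coords : Wsl →ₗ[ℝ] PowerSeries ℝ × PowerSeries ℝ × PowerSeries ℝ := wslSubmodule.subtype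

theorem Wsl.coords_injective : Function.Injective Wsl.coords := Subtype.val_injective

/-- The coefficients of the `X^{(2n+1)}`. -/
def Wsl.b (z : Wsl) : PowerSeries ℝ := z.coords.1
/-- The coefficients of the `Y^{(2m+1)}`. -/
def Wsl.c (z : Wsl) : PowerSeries ℝ := z.coords.2.1
/-- The coefficients of the `XY^{(2k+2)}`. -/
def Wsl.d (z : Wsl) : PowerSeries ℝ := z.coords.2.2

theorem Wsl.hb (z : Wsl) : WSummable z.b := z.2.1
theorem Wsl.hc (z : Wsl) : WSummable z.c := z.2.2.1
theorem Wsl.hd (z : Wsl) : WSummable z.d := z.2.2.2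

@[ext] theorem Wsl.ext {z w : Wsl} (hb : z.b = w.b) (hc : z.c = w.c) (hd : z.d = w.d) : z = w :=
  Wsl.coords_injective (Prod.ext hb (Prod.ext hc hd))

@[simp] theorem Wsl.b_zero : (0 : Wsl).b = 0 := rfl
@[simp] theorem Wsl.c_zero : (0 : Wsl).c = 0 := rfl
@[simp] theorem Wsl.d_zero : (0 : Wsl).d = 0 := rfl
@[simp] theorem Wsl.b_add (z w : Wsl) : (z + w).b = z.b + w.b := rfl
@[simp] theorem Wsl.c_add (z w : Wsl) : (z + w).c = z.c + w.c := rfl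
@[simp] theorem Wsl.d_add (z w : Wsl) : (z + w).d = z.d + w.d := rfl
@[simp] theorem Wsl.b_smul (r : ℝ) (z : Wsl) : (r • z).b = r • z.b := rfl
@[simp] theorem Wsl.c_smul (r : ℝ) (z : Wsl) : (r • z).c = r • z.c := rfl
@[simp] theorem Wsl.d_smul (r : ℝ) (z : Wsl) : (r • z).d = r • z.d := rfl

/-- The bilinear, continuous extension of the commutation rules
`[X^{(2n+1)}, Y^{(2m+1)}] = XY^{(2n+2m+2)}`, `[XY^{(2k)}, X^{(2n+1)}] = 2 X^{(2k+2n+1)}`,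
`[Y^{(2m+1)}, XY^{(2k)}] = 2 Y^{(2k+2m+1)}`, the other brackets of basis elements being zero. With
coefficient sequences written as power series, the sums of indices become products of series, and
the factor `PowerSeries.X` accounts for `d` starting with the coefficient of `XY^{(2)}`. -/
instance : Bracket Wsl Wsl where
  bracket z w :=
    ⟨((2 : ℝ) • (PowerSeries.X * (z.d * w.b - w.d * z.b)),
      (2 : ℝ) • (PowerSeries.X * (z.c * w.d - w.c * z.d)),
      z.b * w.c - w.b * z.c),
      (WSummable.X.mul ((z.hd.mul w.hb).sub (w.hd.mul z.hb))).smul 2,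
      (WSummable.X.mul ((z.hc.mul w.hd).sub (w.hc.mul z.hd))).smul 2,
      (z.hb.mul w.hc).sub (w.hb.mul z.hc)⟩

@[simp] theorem Wsl.b_lie (z w : Wsl) :
    ⁅z, w⁆.b = (2 : ℝ) • (PowerSeries.X * (z.d * w.b - w.d * z.b)) := rfl
@[simp] theorem Wsl.c_lie (z w : Wsl) :
    ⁅z, w⁆.c = (2 : ℝ) • (PowerSeries.X * (z.c * w.d - w.c * z.d)) := rfl
@[simp] theorem Wsl.d_lie (z w : Wsl) : ⁅z, w⁆.d = z.b * w.c - w.b * z.c := rfl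

instance : LieRing Wsl where
  add_lie x y z := by
    ext1 <;> simp only [Wsl.b_lie, Wsl.c_lie, Wsl.d_lie, Wsl.b_add, Wsl.c_add, Wsl.d_add,
      PowerSeries.smul_eq_C_mul] <;> ring
  lie_add x y z := by
    ext1 <;> simp only [Wsl.b_lie, Wsl.c_lie, Wsl.d_lie, Wsl.b_add, Wsl.c_add, Wsl.d_add,
      PowerSeries.smul_eq_C_mul] <;> ring
  lie_self x := by
    ext1 <;> simp
  leibniz_lie x y z := by
    ext1 <;> simp only [Wsl.b_lie, Wsl.c_lie, Wsl.d_lie, Wsl.b_add, Wsl.c_add, Wsl.d_add,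
      PowerSeries.smul_eq_C_mul] <;> ring

instance : LieAlgebra ℝ Wsl where
  lie_smul r x y := by
    ext1 <;> simp only [Wsl.b_lie, Wsl.c_lie, Wsl.d_lie, Wsl.b_smul, Wsl.c_smul, Wsl.d_smul,
      PowerSeries.smul_eq_C_mul] <;> ring

theorem wNorm_add_le {f g : PowerSeries ℝ} (hf : WSummable f) (hg : WSummable g) :
    wNorm (f + g) ≤ wNorm f + wNorm g := by
  rw [wNorm, wNorm, wNorm, ← Summable.tsum_add hf hg]
  refine Summable.tsum_le_tsum (fun n => ?_) (hf.add hg) (Summable.add hf hg)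
  rw [map_add, ← mul_add]
  exact mul_le_mul_of_nonneg_left (abs_add_le _ _) (by positivity)

theorem wNorm_smul (r : ℝ) (f : PowerSeries ℝ) : wNorm (r • f) = |r| * wNorm f := by
  rw [wNorm, wNorm, ← tsum_mul_left]
  refine tsum_congr fun n => ?_
  rw [map_smul, smul_eq_mul, abs_mul]
  ring

theorem wNorm_nonneg (f : PowerSeries ℝ) : 0 ≤ wNorm f := tsum_nonneg fun n => by positivity

theorem eq_zero_of_wNorm_eq_zero {f : PowerSeries ℝ} (hf : WSummable f) (h : wNorm f = 0) :
    f = 0 := by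
  ext n
  have hs : HasSum (fun n : ℕ => (1 / 2 : ℝ) ^ n * |PowerSeries.coeff n f|) 0 :=
    h ▸ (Summable.hasSum hf : HasSum _ (wNorm f))
  have h0 := (hasSum_zero_iff_of_nonneg (fun n => by positivity)).1 hs
  have h1 := congrFun h0 n
  simpa using h1

/-- The norm `‖(b, c, d)‖ = ∑ₙ |bₙ| 2⁻ⁿ + ∑ₘ |cₘ| 2⁻ᵐ + ∑ₖ |dₖ| 2⁻ᵏ`; the index shift in `d` makes the
norm of `XY^{(2k)}` equal to `2^(-k+1)`. -/
instance : NormedAddCommGroup Wsl :=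
  AddGroupNorm.toNormedAddCommGroup
    { toFun := fun z => wNorm z.b + wNorm z.c + wNorm z.d
      map_zero' := by simp [wNorm]
      add_le' := fun z w => by
        have h1 := wNorm_add_le z.hb w.hb
        have h2 := wNorm_add_le z.hc w.hc
        have h3 := wNorm_add_le z.hd w.hd
        simp only [Wsl.b_add, Wsl.c_add, Wsl.d_add]
        linarith
      neg' := fun z => by
        have h : -z = (-1 : ℝ) • z := (neg_one_smul ℝ z).symm
        rw [h]
        simp only [Wsl.b_smul, Wsl.c_smul, Wsl.d_smul, wNorm_smul, abs_neg, abs_one, one_mul]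
      eq_zero_of_map_eq_zero' := fun z h => by
        have h1 := wNorm_nonneg z.b
        have h2 := wNorm_nonneg z.c
        have h3 := wNorm_nonneg z.d
        exact Wsl.ext (eq_zero_of_wNorm_eq_zero z.hb (by linarith))
          (eq_zero_of_wNorm_eq_zero z.hc (by linarith))
          (eq_zero_of_wNorm_eq_zero z.hd (by linarith)) }

theorem Wsl.norm_def (z : Wsl) : ‖z‖ = wNorm z.b + wNorm z.c + wNorm z.d := rfl

instance : NormedSpace ℝ Wsl where
  norm_smul_le r z := by
    simp only [Wsl.norm_def, Wsl.b_smul, Wsl.c_smul, Wsl.d_smul, wNorm_smul, Real.norm_eq_abs]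
    exact le_of_eq (by ring)

/-- An element of `wsl₂¹` as a formal series of homogeneous elements of the associative algebra, the
power of the variable recording the degree in `X` and `Y`. -/
def Wsl.toFormal (z : Wsl) : PowerSeries SqZeroAlg :=
  PowerSeries.mk fun n =>
    if n % 2 = 1 then
      PowerSeries.coeff (n / 2) z.b • oddX (n / 2) + PowerSeries.coeff (n / 2) z.c • oddY (n / 2)
    else if n = 0 then 0
    else PowerSeries.coeff (n / 2 - 1) z.d • evenXY (n / 2)

/-! ## A Banach–Lie norm on `sl₂(ℝ)` -/

/-- The Lie algebra of real `2 × 2` matrices of trace zero, to be given its own norm. -/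
def Sl2 : Type := ↥(LieAlgebra.SpecialLinear.sl (Fin 2) ℝ)

instance : LieRing Sl2 := inferInstanceAs (LieRing ↥(LieAlgebra.SpecialLinear.sl (Fin 2) ℝ))
instance : LieAlgebra ℝ Sl2 :=
  inferInstanceAs (LieAlgebra ℝ ↥(LieAlgebra.SpecialLinear.sl (Fin 2) ℝ))

/-- The underlying matrix. -/
def Sl2.mat : Sl2 →ₗ⁅ℝ⁆ Matrix (Fin 2) (Fin 2) ℝ := (LieAlgebra.SpecialLinear.sl (Fin 2) ℝ).incl

theorem Sl2.mat_injective : Function.Injective Sl2.mat := Subtype.val_injective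

theorem Sl2.trace_mat (z : Sl2) : z.mat 0 0 + z.mat 1 1 = 0 := by
  have h : Matrix.trace z.mat = 0 := LinearMap.mem_ker.1 z.2
  rwa [Matrix.trace_fin_two] at h

/-- The matrix `S(a, b, c)`. -/
def matS (a b c : ℝ) : Matrix (Fin 2) (Fin 2) ℝ := !![a, √2 * b; √2 * c, -a]

/-- `S(a, b, c)` as an element of `sl₂`. -/
def Sl2.S (a b c : ℝ) : Sl2 :=
  ⟨matS a b c, LinearMap.mem_ker.2 (by simp [Matrix.traceLinearMap, matS, Matrix.trace_fin_two])⟩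

/-- The matrix `X̂`, with the single nonzero entry `√2 / 2` in the upper right corner. -/
def sl2X : Sl2 := Sl2.S 0 (1 / 2) 0

/-- The matrix `Ŷ`, with the single nonzero entry `√2 / 2` in the lower left corner. -/
def sl2Y : Sl2 := Sl2.S 0 0 (1 / 2)

/-- The linear map `S(a, b, c) ↦ 2 (a, b, c)` to Euclidean space. -/
def Sl2.vec : Sl2 →ₗ[ℝ] EuclideanSpace ℝ (Fin 3) where
  toFun z := (2 : ℝ) • !₂[z.mat 0 0, z.mat 0 1 / √2, z.mat 1 0 / √2]
  map_add' z w := by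
    ext i
    fin_cases i <;> simp <;> ring
  map_smul' r z := by
    ext i
    fin_cases i <;> simp <;> ring

theorem Sl2.vec_injective : Function.Injective Sl2.vec := by
  intro z w h
  have h2 : (√2 : ℝ) ≠ 0 := by positivity
  have e0 := congrArg (fun v => v 0) h
  have e1 := congrArg (fun v => v 1) h
  have e2 := congrArg (fun v => v 2) h
  simp [Sl2.vec] at e0 e1 e2
  have e1' : z.mat 0 1 = w.mat 0 1 := e1
  have e2' : z.mat 1 0 = w.mat 1 0 := e2
  have hz := z.trace_mat
  have hw := w.trace_mat
  apply Sl2.mat_injective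
  ext i j
  fin_cases i <;> fin_cases j
  · exact e0
  · exact e1'
  · exact e2'
  · change z.mat 1 1 = w.mat 1 1
    linarith

/-- The norm `‖S(v)‖ = 2 |v|`, where `|v|` is the Euclidean norm. -/
instance : NormedAddCommGroup Sl2 := NormedAddCommGroup.induced Sl2 _ Sl2.vec Sl2.vec_injective
instance : NormedSpace ℝ Sl2 := NormedSpace.induced ℝ Sl2 _ Sl2.vec

/-- The closed form `2 arsinh(2^(-3/2) t) / √(8 + t²)` times `S(t, 2, 2)`, the matrix with rows
`(t, 2√2)` and `(2√2, -t)`. -/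
def sl2Log (t : ℝ) : Sl2 :=
  (2 * Real.arsinh (t / (2 * √2)) / √(8 + t ^ 2)) • Sl2.S t 2 2

end LieBCH

end

open LieBCH

/-!
The BCH series of two elements `x, y` with `x² = y² = 0` can be computed in closed form. Then
`exp x = 1 + x` and `exp y = 1 + y`, and `u = exp x exp y - 1 = x + y + xy` satisfies
`u² = P (1 + u)`, where `P = xy + yx` commutes with `u`. Hence the powers of `u` are combinations of
the `Pⁱ u` and `Pⁱ⁺¹` with binomial coefficients (`pow_add_two_eq`), and the coefficients of
`log (1 + u)` are alternating sums of binomial coefficients which are beta integrals, equal to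
`± κᵢ` and `∓ κᵢ / 2` (`sum_log_eq`). The formulas `bchTerm_odd` and `bchTerm_even` follow. They
apply to `X, Y` and, in the same way, to the matrices `X̂, Ŷ`.

The algebra `SqZeroAlg` acts on `ℝ⟦s⟧²` by `X ↦ E₁₂`, `Y ↦ s E₂₁` (`matRep`). The matrices of the
proposed basis elements are visibly linearly independent, and `wsl₂¹` is, by `wslMat`, a Lie algebra
of such matrices as well; the embedding `wslEmb` of `wsl₂^alg` compares the two.

All questions of convergence come down to `1 / (2k + 1) ≤ 4ᵏ κₖ ≤ 1`, which locates the radius of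
convergence at `t² = 8` and shows that the series of norms still diverges there. In `wsl₂¹` the
coefficient of every basis element is a continuous functional, so convergence of the partial sums
would force the closed form to be summable. The same holds for any formal logarithm in `wsl₂¹`,
because the formal exponential is injective on series without constant term
(`formalLog_formalExp`). The closed sums come from the differential equation
`(1 - ε x²) h' = 1 + ε x h` for `h = ∑ εᵏ 4ᵏ κₖ x²ᵏ⁺¹` with `ε = ± 1` (`hasSum_kappaFour`). That
`L(t)` is a logarithm for all `t` is a computation with the involution `J` for which
`L(t) = 2 arsinh (t / (2√2)) J`.

Finally, `wsl₂¹` is a Banach–Lie algebra in which `X` and `Y` have norm one, so evaluation of Lie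
polynomials at `(X, Y)` does not increase norms (`ofReal_norm_bchWsl_le`). The norms of the
homogeneous parts of `BCH(X, Y)` therefore bound the coefficients of `Γ^Lie(t, t)` from below, and
their series is `Ξ(t)`, which diverges at `t = 2√2`.
-/

noncomputable section

namespace LieBCH

open Finset

/-! ### Formal exponential and logarithm -/

section FormalSeries

variable {A : Type*} [Ring A] {σ : Type*}

theorem coeff_pow_eq_zero_of_degree_lt {f : MvPowerSeries σ A}
    (hf : MvPowerSeries.constantCoeff f = 0) {d : σ →₀ ℕ} {k : ℕ} (h : d.degree < k) :
    MvPowerSeries.coeff d (f ^ k) = 0 := by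
  apply MvPowerSeries.coeff_of_lt_order
  refine lt_of_lt_of_le ?_ (MvPowerSeries.le_order_pow_of_constantCoeff_eq_zero k hf)
  exact_mod_cast h

/-- Agreement of two series up to degree `N` is inherited by their powers. -/
theorem coeff_pow_congr {f g : MvPowerSeries σ A} {N : ℕ}
    (h : ∀ d : σ →₀ ℕ, d.degree ≤ N → MvPowerSeries.coeff d f = MvPowerSeries.coeff d g) (k : ℕ) :
    ∀ d : σ →₀ ℕ, d.degree ≤ N →
      MvPowerSeries.coeff d (f ^ k) = MvPowerSeries.coeff d (g ^ k) := by
  classical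
  induction k with
  | zero => intro d _; simp
  | succ k ih =>
    intro d hd
    rw [pow_succ, pow_succ, MvPowerSeries.coeff_mul, MvPowerSeries.coeff_mul]
    refine sum_congr rfl fun p hp => ?_
    have hp' : p.1.degree + p.2.degree = d.degree := by
      rw [← Finset.HasAntidiagonal.mem_antidiagonal.1 hp]; simp
    rw [ih p.1 (by omega), h p.2 (by omega)]

variable [Algebra ℝ A]

theorem coeff_real_smul (c : ℝ) (d : σ →₀ ℕ) (f : MvPowerSeries σ A) :
    MvPowerSeries.coeff d (c • f) = c • MvPowerSeries.coeff d f := rfl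

/-- The Taylor polynomial of degree `N` of the exponential function. -/
def expPoly (N : ℕ) : Polynomial ℝ :=
  ∑ k ∈ range (N + 1), Polynomial.C ((k.factorial : ℝ)⁻¹) * Polynomial.X ^ k

theorem coeff_expPoly_zero (N : ℕ) : (expPoly N).coeff 0 = 1 := by
  simp [expPoly, Polynomial.coeff_X_pow]

theorem derivative_expPoly (N : ℕ) :
    Polynomial.derivative (expPoly N) =
      expPoly N - Polynomial.C ((N.factorial : ℝ)⁻¹) * Polynomial.X ^ N := by
  rw [expPoly, Polynomial.derivative_sum, sum_range_succ', sum_range_succ]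
  simp only [Polynomial.derivative_C_mul_X_pow, add_sub_cancel_right]
  simp only [CharP.cast_eq_zero, mul_zero, map_zero, zero_mul, add_zero]
  refine sum_congr rfl fun k _ => ?_
  congr 2
  rw [Nat.factorial_succ]
  push_cast
  field_simp

/-- The truncated logarithm of the truncated exponential. -/
def logExpPoly (N : ℕ) : Polynomial ℝ :=
  ∑ k ∈ Icc 1 N, Polynomial.C ((-1 : ℝ) ^ (k + 1) / k) * (expPoly N - 1) ^ k

/-- The derivative of the truncated `log (exp s)` is `1` modulo `s ^ N`, by the geometric series. -/
theorem X_pow_dvd_derivative_logExpPoly (N : ℕ) :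
    (Polynomial.X : Polynomial ℝ) ^ N ∣ Polynomial.derivative (logExpPoly N) - 1 := by
  have h1 : (Polynomial.X : Polynomial ℝ) ∣ 1 - expPoly N := by
    rw [Polynomial.X_dvd_iff, Polynomial.coeff_sub, coeff_expPoly_zero]; simp
  have h2 : Polynomial.derivative (logExpPoly N) =
      (∑ i ∈ range N, (1 - expPoly N) ^ i) * Polynomial.derivative (expPoly N) := by
    rw [logExpPoly, Polynomial.derivative_sum, range_eq_Ico, sum_mul,
      show Icc 1 N = Ico (0 + 1) (N + 1) from rfl, ← sum_Ico_add']
    refine sum_congr rfl fun k _ => ?_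
    have hk : ((k : ℝ) + 1) ≠ 0 := by positivity
    rw [Polynomial.derivative_C_mul, Polynomial.derivative_pow, Polynomial.derivative_sub,
      Polynomial.derivative_one, sub_zero, add_tsub_cancel_right, ← mul_assoc, ← mul_assoc,
      ← Polynomial.C_mul, Nat.cast_add, Nat.cast_one, div_mul_cancel₀ _ hk, pow_succ, pow_succ,
      ← neg_sub (1 : Polynomial ℝ), neg_pow (1 - expPoly N)]
    simp only [map_mul, map_pow, map_neg, map_one]
    have : ((-1 : Polynomial ℝ) ^ k) * (-1) ^ k = 1 := by rw [← mul_pow]; simp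
    linear_combination (1 - expPoly N) ^ k * Polynomial.derivative (expPoly N) * this
  have h3 := geom_sum_mul_neg (1 - expPoly N) N
  rw [sub_sub_cancel] at h3
  rw [h2, derivative_expPoly, mul_sub, h3]
  have h4 : (Polynomial.X : Polynomial ℝ) ^ N ∣ (1 - expPoly N) ^ N := pow_dvd_pow_of_dvd h1 N
  obtain ⟨q, hq⟩ := h4
  refine ⟨-q - (∑ i ∈ range N, (1 - expPoly N) ^ i) * Polynomial.C ((N.factorial : ℝ)⁻¹), ?_⟩
  rw [hq]; ring

theorem coeff_logExpPoly {N i : ℕ} (hi : i ≤ N) :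
    (logExpPoly N).coeff i = if i = 1 then 1 else 0 := by
  rcases i with _ | i
  · rw [Polynomial.coeff_zero_eq_eval_zero, logExpPoly, Polynomial.eval_finsetSum, if_neg (by simp)]
    refine sum_eq_zero fun k hk => ?_
    have hk' : k ≠ 0 := by have := (mem_Icc.1 hk).1; omega
    rw [Polynomial.eval_mul, Polynomial.eval_pow, Polynomial.eval_sub,
      ← Polynomial.coeff_zero_eq_eval_zero (expPoly N), coeff_expPoly_zero]
    simp [hk']
  · have h := (Polynomial.X_pow_dvd_iff.1 (X_pow_dvd_derivative_logExpPoly N)) i (by omega)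
    rw [Polynomial.coeff_sub, Polynomial.coeff_derivative, Polynomial.coeff_one] at h
    have hpos : ((i : ℝ) + 1) ≠ 0 := by positivity
    rcases i with _ | i
    · simp at h ⊢; linarith
    · simp only [if_neg (Nat.succ_ne_zero i), sub_zero, mul_eq_zero, hpos, or_false] at h
      simp [h]

/-- The formal logarithm inverts the formal exponential. Up to degree `N`, the series involved are
values at `f` of polynomials, so this is a statement about polynomials in one variable. -/
theorem formalLog_formalExp {f : MvPowerSeries σ A} (hf : MvPowerSeries.constantCoeff f = 0) :
    formalLog (formalExp f) = f := by
  classical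
  ext d
  have key : ∀ e : σ →₀ ℕ, e.degree ≤ d.degree → MvPowerSeries.coeff e (formalExp f - 1) =
      MvPowerSeries.coeff e (Polynomial.aeval f (expPoly d.degree - 1)) := by
    intro e he
    rw [map_sub, map_sub (Polynomial.aeval (R := ℝ) f), map_one (Polynomial.aeval (R := ℝ) f),
      map_sub]
    congr 1
    change ∑ k ∈ range (e.degree + 1), _ = _
    rw [expPoly, map_sum, map_sum]
    rw [← sum_subset (range_mono (Nat.succ_le_succ he))]
    · refine sum_congr rfl fun k _ => ?_
      rw [map_mul, map_pow (Polynomial.aeval (R := ℝ) f), Polynomial.aeval_X, Polynomial.aeval_C,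
        ← Algebra.smul_def,
        coeff_real_smul]
    · intro k _ hk
      rw [map_mul, map_pow (Polynomial.aeval (R := ℝ) f), Polynomial.aeval_X, Polynomial.aeval_C,
        ← Algebra.smul_def,
        coeff_real_smul, coeff_pow_eq_zero_of_degree_lt hf (by simp at hk; omega), smul_zero]
  have h1 : MvPowerSeries.coeff d (formalLog (formalExp f)) =
      MvPowerSeries.coeff d (Polynomial.aeval f (logExpPoly d.degree)) := by
    change ∑ k ∈ Icc 1 d.degree, _ = _
    rw [logExpPoly, map_sum, map_sum]
    refine sum_congr rfl fun k _ => ?_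
    rw [map_mul, map_pow (Polynomial.aeval (R := ℝ) f), Polynomial.aeval_C, ← Algebra.smul_def,
      coeff_real_smul, coeff_pow_congr key k d le_rfl]
  rw [h1, Polynomial.aeval_eq_sum_range, map_sum]
  have h2 : ∀ i, MvPowerSeries.coeff d ((logExpPoly d.degree).coeff i • f ^ i) =
      if i = 1 then MvPowerSeries.coeff d f else 0 := by
    intro i
    rw [coeff_real_smul]
    by_cases hi : i ≤ d.degree
    · rw [coeff_logExpPoly hi]
      split_ifs with h
      · rw [h, one_smul, pow_one]
      · rw [zero_smul]
    · rw [coeff_pow_eq_zero_of_degree_lt hf (not_le.1 hi), smul_zero]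
      split_ifs with h
      · subst h
        have := coeff_pow_eq_zero_of_degree_lt hf (not_le.1 hi)
        rw [pow_one] at this
        exact this.symm
      · rfl
  simp only [h2, sum_ite_eq', mem_range]
  split_ifs with h
  · rfl
  · by_cases hd : 1 ≤ d.degree
    · exfalso
      have h0 := coeff_logExpPoly hd
      rw [Polynomial.coeff_eq_zero_of_natDegree_lt (by omega)] at h0
      simp at h0
    · have := coeff_pow_eq_zero_of_degree_lt hf (not_le.1 hd)
      rw [pow_one] at this
      exact this.symm

theorem formalExp_map {B : Type*} [Ring B] [Algebra ℝ B] (φ : A →ₐ[ℝ] B) (f : MvPowerSeries σ A) :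
    formalExp (MvPowerSeries.map φ.toRingHom f) = MvPowerSeries.map φ.toRingHom (formalExp f) := by
  ext d
  rw [MvPowerSeries.coeff_map]
  change ∑ k ∈ range (d.degree + 1), _ = φ (∑ k ∈ range (d.degree + 1), _)
  rw [map_sum]
  refine sum_congr rfl fun k _ => ?_
  rw [← map_pow, MvPowerSeries.coeff_map, map_smul]
  rfl

theorem formalLog_map {B : Type*} [Ring B] [Algebra ℝ B] (φ : A →ₐ[ℝ] B) (f : MvPowerSeries σ A) :
    formalLog (MvPowerSeries.map φ.toRingHom f) = MvPowerSeries.map φ.toRingHom (formalLog f) := by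
  ext d
  rw [MvPowerSeries.coeff_map]
  change ∑ k ∈ Icc 1 d.degree, _ = φ (∑ k ∈ Icc 1 d.degree, _)
  rw [map_sum]
  refine sum_congr rfl fun k _ => ?_
  rw [← map_one (MvPowerSeries.map φ.toRingHom), ← map_sub, ← map_pow, MvPowerSeries.coeff_map,
    map_smul]
  rfl

/-- The homogeneous parts of the BCH series are natural in the algebra. -/
theorem bchTerm_map {B : Type*} [Ring B] [Algebra ℝ B] (φ : A →ₐ[ℝ] B) (n : ℕ) (a b : A) :
    bchTerm n (φ a) (φ b) = φ (bchTerm n a b) := by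
  have hs : bchSeries (φ a) (φ b) = MvPowerSeries.map φ.toRingHom (bchSeries a b) := by
    rw [bchSeries, bchSeries, ← formalLog_map, map_mul, ← formalExp_map, ← formalExp_map,
      MvPowerSeries.map_monomial, MvPowerSeries.map_monomial]
    rfl
  rw [bchTerm, bchTerm, map_sum]
  refine sum_congr rfl fun pq _ => ?_
  rw [bchPart, hs, MvPowerSeries.coeff_map]
  rfl

end FormalSeries

/-! ### The BCH series of two elements of square zero -/

/-- The Euler beta integral `∫₀¹ xᵃ (1 - x)ⁿ dx`, expanded by the binomial theorem. -/
theorem sum_neg_one_pow_mul_choose_div (n a : ℕ) :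
    ∑ j ∈ range (n + 1), (-1 : ℝ) ^ j * n.choose j / (a + j + 1) =
      a.factorial * n.factorial / (a + n + 1).factorial := by
  induction n generalizing a with
  | zero =>
    simp [Nat.factorial_succ]
    field_simp
  | succ n ih =>
    have hstep : ∑ j ∈ range (n + 1 + 1), (-1 : ℝ) ^ j * (n + 1).choose j / (a + j + 1) =
        ∑ j ∈ range (n + 1), (-1 : ℝ) ^ j * n.choose j / (a + j + 1) -
        ∑ j ∈ range (n + 1), (-1 : ℝ) ^ j * n.choose j / ((a + 1 : ℕ) + j + 1) := by
      rw [sum_range_succ', ← sub_eq_zero]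
      have h1 : ∑ j ∈ range (n + 1), (-1 : ℝ) ^ j * n.choose j / (a + j + 1) =
          ∑ j ∈ range (n + 1), (-1 : ℝ) ^ (j + 1) * n.choose (j + 1) / (a + (j + 1 : ℕ) + 1) +
            1 / (a + 1) := by
        calc _ = ∑ j ∈ range (n + 2), (-1 : ℝ) ^ j * n.choose j / (a + j + 1) := by
              rw [sum_range_succ _ (n + 1)]; simp
          _ = _ := by rw [sum_range_succ']; simp
      rw [h1]
      simp only [Nat.choose_succ_succ]
      have h2 : ∑ j ∈ range (n + 1), (-1 : ℝ) ^ (j + 1) * (n.choose j + n.choose (j + 1) : ℕ) /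
          (a + (j + 1 : ℕ) + 1) =
          ∑ j ∈ range (n + 1), (-1 : ℝ) ^ (j + 1) * n.choose (j + 1) / (a + (j + 1 : ℕ) + 1) -
          ∑ j ∈ range (n + 1), (-1 : ℝ) ^ j * n.choose j / ((a + 1 : ℕ) + j + 1) := by
        rw [← sum_sub_distrib]
        refine sum_congr rfl fun j _ => ?_
        push_cast
        rw [show (a : ℝ) + (j + 1) + 1 = a + 1 + j + 1 by ring]
        ring
      rw [h2]
      simp
      ring
    rw [hstep, ih, ih]
    have e1 : (a + (n + 1) + 1).factorial = (a + n + 2) * (a + n + 1).factorial :=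
      Nat.factorial_succ _
    have e2 : (a + 1 + n + 1).factorial = (a + n + 2) * (a + n + 1).factorial := by
      rw [← e1]; congr 1; ring
    rw [e1, e2, Nat.factorial_succ a, Nat.factorial_succ n]
    have : ((a + n + 1).factorial : ℝ) ≠ 0 := by positivity
    push_cast
    field_simp
    ring

/-- The polynomials `∑ᵢ C(i, m - i) Pⁱ`, which express the powers of an element `u` with
`u² = P (1 + u)` in terms of `P` and `u`. -/
def powCoeff {R : Type*} [Semiring R] (P : R) (m : ℕ) : R :=
  ∑ ij ∈ antidiagonal m, ij.1.choose ij.2 • P ^ ij.1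

section Ring

variable {R : Type*} [Ring R]

theorem powCoeff_add_two (P : R) (m : ℕ) :
    powCoeff P (m + 2) = powCoeff P (m + 1) * P + powCoeff P m * P := by
  have h : ∀ ij : ℕ × ℕ, (ij.1 + 1).choose ij.2 • P ^ (ij.1 + 1) =
      ij.1.choose ij.2 • P ^ ij.1 * P +
        (if ij.2 = 0 then 0 else ij.1.choose (ij.2 - 1)) • P ^ ij.1 * P := by
    rintro ⟨i, _ | j⟩
    · simp [pow_succ]
    · simp [Nat.choose_succ_succ, pow_succ, add_smul, add_comm, mul_assoc]
  rw [powCoeff, Nat.antidiagonal_succ, sum_cons, sum_map]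
  simp only [Function.Embedding.prodMap, Function.Embedding.coeFn_mk, Prod.map]
  simp only [Function.Embedding.refl_apply, Nat.succ_eq_add_one]
  rw [Nat.choose_zero_succ, zero_smul, zero_add, sum_congr rfl fun ij _ => h ij, sum_add_distrib,
    powCoeff, powCoeff, sum_mul, sum_mul]
  congr 1
  rw [Nat.antidiagonal_succ', sum_cons, sum_map]
  simp

/-- The powers of a root of `u² = P (1 + u)`, reduced to the form `F u + G`. -/
theorem pow_add_two_eq {P u : R} (h : u * u = P * (1 + u)) (m : ℕ) :
    u ^ (m + 2) = powCoeff P (m + 1) * u + powCoeff P m * P := by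
  induction m with
  | zero => simp [powCoeff, pow_two, h, Nat.antidiagonal_succ]; noncomm_ring
  | succ m ih =>
    rw [pow_succ, ih, powCoeff_add_two, add_mul, mul_assoc, h]
    noncomm_ring

variable [Algebra ℝ R] {V : Type*} [AddCommGroup V] [Module ℝ V]

/-- Summation over a triangle, when only the indices with `j ≤ i` contribute and only small `i`
occur. -/
theorem sum_range_antidiagonal_eq {c : ℕ → ℕ → ℝ} {a : ℕ → V} {N : ℕ}
    (hc : ∀ i j, i < j → c i j = 0) (ha : ∀ i, N ≤ 2 * i → a i = 0) :
    ∑ m ∈ range N, ∑ ij ∈ antidiagonal m, c ij.1 ij.2 • a ij.1 =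
      ∑ i ∈ range N, (∑ j ∈ range (i + 1), c i j) • a i := by
  have h1 : ∀ m ∈ range N, ∑ ij ∈ antidiagonal m, c ij.1 ij.2 • a ij.1 =
      ∑ ij ∈ (range N ×ˢ range N) with ij.1 + ij.2 = m, c ij.1 ij.2 • a ij.1 := by
    intro m hm
    have hm' := mem_range.1 hm
    refine sum_congr ?_ fun _ _ => rfl
    ext ⟨i, j⟩
    simp only [HasAntidiagonal.mem_antidiagonal, mem_filter, mem_product, mem_range]
    omega
  have h2 : ∑ ij ∈ range N ×ˢ range N, c ij.1 ij.2 • a ij.1 =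
      ∑ m ∈ range (2 * N), ∑ ij ∈ (range N ×ˢ range N) with ij.1 + ij.2 = m,
        c ij.1 ij.2 • a ij.1 := by
    rw [sum_fiberwise_of_maps_to]
    rintro ⟨i, j⟩ hij
    simp only [mem_product, mem_range] at hij ⊢
    omega
  rw [sum_congr rfl h1]
  have h3 : ∑ m ∈ range N, ∑ ij ∈ (range N ×ˢ range N) with ij.1 + ij.2 = m,
        c ij.1 ij.2 • a ij.1 = ∑ m ∈ range (2 * N),
          ∑ ij ∈ (range N ×ˢ range N) with ij.1 + ij.2 = m, c ij.1 ij.2 • a ij.1 := by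
    refine sum_subset (range_mono (by omega)) fun m _ hm => sum_eq_zero ?_
    rintro ⟨i, j⟩ hij
    simp only [mem_filter, mem_product, mem_range] at hij hm
    by_cases hlt : i < j
    · simp [hc i j hlt]
    · simp [ha i (by omega)]
  rw [h3, ← h2, sum_product]
  refine sum_congr rfl fun i hi => ?_
  rw [sum_smul]
  refine (sum_subset (range_mono (by simpa using hi)) fun j _ hj => ?_).symm
  rw [hc i j (by simp at hj; omega), zero_smul]

/-- The sum is the beta integral `∫₀¹ xⁱ (1 - x)ⁱ dx`, up to the sign. -/
theorem kappa_eq_sum (i : ℕ) :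
    ∑ j ∈ range (i + 1), (-1 : ℝ) ^ (i + j) / ((i + j : ℕ) + 1) * i.choose j =
      (-1) ^ i * kappa i := by
  have h := sum_neg_one_pow_mul_choose_div i i
  rw [kappa, two_mul, pow_two, ← h, mul_sum]
  refine sum_congr rfl fun j _ => ?_
  push_cast
  ring

/-- The sum is the beta integral `∫₀¹ xⁱ⁺¹ (1 - x)ⁱ dx`, which by the symmetry `x ↦ 1 - x` is half
of the integral `∫₀¹ xⁱ (1 - x)ⁱ dx = κᵢ`. -/
theorem neg_half_kappa_eq_sum (i : ℕ) :
    ∑ j ∈ range (i + 1), (-1 : ℝ) ^ (i + j + 1) / ((i + j : ℕ) + 2) * i.choose j =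
      -((-1) ^ i * kappa i) / 2 := by
  have h := sum_neg_one_pow_mul_choose_div i (i + 1)
  have h2 : kappa i / 2 = (i + 1).factorial * i.factorial / (i + 1 + i + 1).factorial := by
    rw [kappa, show i + 1 + i + 1 = (2 * i + 1) + 1 by ring, Nat.factorial_succ (2 * i + 1),
      Nat.factorial_succ i]
    have : ((2 * i + 1).factorial : ℝ) ≠ 0 := by positivity
    push_cast
    field_simp
    ring
  rw [neg_div, mul_div_assoc, h2, ← h, mul_sum, ← sum_neg_distrib]
  refine sum_congr rfl fun j _ => ?_
  push_cast
  rw [show (i : ℝ) + 1 + j + 1 = i + j + 2 by ring]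
  ring

/-- The logarithmic series of `1 + u` for `u² = P (1 + u)`, seen through a linear map that vanishes
on terms of high degree. -/
theorem sum_log_eq {P u : R} (h : u * u = P * (1 + u)) (l : R →ₗ[ℝ] V) {N : ℕ}
    (h1 : ∀ i, N ≤ 2 * i → l (P ^ i * u) = 0) (h2 : ∀ i, N ≤ 2 * i + 1 → l (P ^ (i + 1)) = 0) :
    ∑ m ∈ range N, ((-1 : ℝ) ^ m / (m + 1)) • l (u ^ (m + 1)) =
      ∑ i ∈ range N, ((-1 : ℝ) ^ i * kappa i) • l (P ^ i * u - (1 / 2 : ℝ) • P ^ (i + 1)) := by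
  rcases N with _ | N
  · simp
  have hF : ∀ m (v : R), l (powCoeff P m * v) =
      ∑ ij ∈ antidiagonal m, (ij.1.choose ij.2 : ℝ) • l (P ^ ij.1 * v) := by
    intro m v
    rw [powCoeff, sum_mul, map_sum]
    refine sum_congr rfl fun ij _ => ?_
    rw [smul_mul_assoc, map_nsmul, Nat.cast_smul_eq_nsmul]
  have e1 : ∑ m ∈ range (N + 1), ((-1 : ℝ) ^ m / (m + 1)) • l (powCoeff P m * u) =
      ∑ i ∈ range (N + 1), ((-1 : ℝ) ^ i * kappa i) • l (P ^ i * u) := by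
    simp_rw [← kappa_eq_sum]
    rw [← sum_range_antidiagonal_eq
      (c := fun i j => (-1 : ℝ) ^ (i + j) / ((i + j : ℕ) + 1) * i.choose j)
      (a := fun i => l (P ^ i * u)) (fun i j hij => by simp [Nat.choose_eq_zero_of_lt hij]) h1]
    refine sum_congr rfl fun m _ => ?_
    rw [hF, smul_sum]
    refine sum_congr rfl fun ij hij => ?_
    rw [smul_smul, HasAntidiagonal.mem_antidiagonal.1 hij]
  have e2 : ∑ m ∈ range N, ((-1 : ℝ) ^ (m + 1) / (m + 2)) • l (powCoeff P m * P) =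
      ∑ i ∈ range N, (-((-1 : ℝ) ^ i * kappa i) / 2) • l (P ^ (i + 1)) := by
    simp_rw [← neg_half_kappa_eq_sum]
    rw [← sum_range_antidiagonal_eq
      (c := fun i j => (-1 : ℝ) ^ (i + j + 1) / ((i + j : ℕ) + 2) * i.choose j)
      (a := fun i => l (P ^ (i + 1))) (fun i j hij => by simp [Nat.choose_eq_zero_of_lt hij])
      (fun i hi => h2 i (by omega))]
    refine sum_congr rfl fun m _ => ?_
    rw [hF, smul_sum]
    refine sum_congr rfl fun ij hij => ?_
    rw [smul_smul, HasAntidiagonal.mem_antidiagonal.1 hij, pow_succ P]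
  have e3 : ∑ m ∈ range (N + 1), ((-1 : ℝ) ^ m / (m + 1)) • l (u ^ (m + 1)) =
      ∑ m ∈ range (N + 1), ((-1 : ℝ) ^ m / (m + 1)) • l (powCoeff P m * u) +
        ∑ m ∈ range N, ((-1 : ℝ) ^ (m + 1) / (m + 2)) • l (powCoeff P m * P) := by
    rw [sum_range_succ', sum_range_succ' _ N, add_right_comm, ← sum_add_distrib]
    congr 1
    · refine sum_congr rfl fun m _ => ?_
      rw [pow_add_two_eq h, map_add, smul_add]
      push_cast
      rw [show (m : ℝ) + 1 + 1 = m + 2 by ring]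
    · simp [powCoeff]
  have e4 : ∑ i ∈ range N, (-((-1 : ℝ) ^ i * kappa i) / 2) • l (P ^ (i + 1)) =
      ∑ i ∈ range (N + 1), (-((-1 : ℝ) ^ i * kappa i) / 2) • l (P ^ (i + 1)) := by
    rw [sum_range_succ, h2 N (by omega), smul_zero, add_zero]
  rw [e3, e1, e2, e4, ← sum_add_distrib]
  refine sum_congr rfl fun i _ => ?_
  rw [map_sub, map_smul, smul_sub, smul_smul, sub_eq_add_neg, ← neg_smul]
  congr 2
  ring

end Ring

section SquareZero

variable {R : Type*} [Ring R] {x y : R}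

theorem mul_pow_mul_self_eq_zero (hx : x * x = 0) (n : ℕ) : x * ((x * y) ^ n * x) = 0 := by
  rcases n with _ | n
  · simpa using hx
  · rw [pow_succ', mul_assoc, mul_assoc, ← mul_assoc x, hx, zero_mul]

theorem pow_succ_mul_eq_zero (hy : y * y = 0) (n : ℕ) : (x * y) ^ (n + 1) * y = 0 := by
  rw [pow_succ, mul_assoc, mul_assoc, hy, mul_zero, mul_zero]

theorem add_pow_succ_eq (hx : x * x = 0) (hy : y * y = 0) (n : ℕ) :
    (x * y + y * x) ^ (n + 1) = (x * y) ^ (n + 1) + (y * x) ^ (n + 1) := by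
  induction n with
  | zero => simp
  | succ n ih =>
    have e1 : (x * y) ^ (n + 1) * (y * x) = 0 := by
      rw [← mul_assoc, pow_succ_mul_eq_zero hy, zero_mul]
    have e2 : (y * x) ^ (n + 1) * (x * y) = 0 := by
      rw [← mul_assoc, pow_succ_mul_eq_zero hx, zero_mul]
    rw [pow_succ, ih, add_mul, mul_add, mul_add, e1, e2, add_zero, zero_add, ← pow_succ, ← pow_succ]

theorem add_pow_mul_eq (hx : x * x = 0) (hy : y * y = 0) (n : ℕ) :
    (x * y + y * x) ^ n * (x + y + x * y) =
      (x * y) ^ n * x + (y * x) ^ n * y + (x * y) ^ (n + 1) := by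
  rcases n with _ | n
  · simp
  · rw [add_pow_succ_eq hx hy, add_mul, mul_add, mul_add, mul_add, mul_add, pow_succ_mul_eq_zero hy,
      pow_succ_mul_eq_zero hx, ← mul_assoc ((y * x) ^ (n + 1)), pow_succ_mul_eq_zero hx, zero_mul,
      ← pow_succ]
    abel

/-- For `x² = y² = 0`, the element `u = (1 + x) (1 + y) - 1` satisfies a quadratic equation over the
element `xy + yx`, which commutes with it. -/
theorem sq_one_add_mul_one_add_sub_one (hx : x * x = 0) (hy : y * y = 0) :
    (x + y + x * y) * (x + y + x * y) = (x * y + y * x) * (1 + (x + y + x * y)) := by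
  have h := add_pow_mul_eq hx hy 1
  rw [pow_one] at h
  rw [mul_add (x * y + y * x), h]
  have e1 : y * (x * y) = y * x * y := (mul_assoc _ _ _).symm
  have e2 : x * y * y = 0 := by rw [mul_assoc, hy, mul_zero]
  have e3 : x * (x * y) = 0 := by rw [← mul_assoc, hx, zero_mul]
  simp only [add_mul, mul_add, hx, hy, e1, e2, e3, pow_one, mul_one,
    show 1 + 1 = 2 from rfl, pow_two]
  abel

variable {A : Type*} [Ring A] {σ : Type*}

theorem monomial_mul_pow_mul (e e' : σ →₀ ℕ) (a b : A) (n : ℕ) :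
    (MvPowerSeries.monomial e a * MvPowerSeries.monomial e' b) ^ n =
      MvPowerSeries.monomial (n • (e + e')) ((a * b) ^ n) := by
  rw [MvPowerSeries.monomial_mul_monomial]
  induction n with
  | zero => simp [MvPowerSeries.monomial_zero_one]
  | succ n ih => rw [pow_succ, ih, MvPowerSeries.monomial_mul_monomial, succ_nsmul, pow_succ]

variable [Algebra ℝ A]

/-- The exponential series of an element of square zero is affine. -/
theorem formalExp_monomial {a : A} (ha : a * a = 0) {e : σ →₀ ℕ} (he : e.degree = 1) :
    formalExp (MvPowerSeries.monomial e a) = 1 + MvPowerSeries.monomial e a := by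
  classical
  have h2 : ∀ k, (MvPowerSeries.monomial e a) ^ (k + 2) = 0 := by
    intro k
    rw [pow_add, pow_two, MvPowerSeries.monomial_mul_monomial, ha, map_zero, mul_zero]
  ext d
  change ∑ k ∈ range (d.degree + 1), _ = _
  rw [sum_range_succ']
  rcases h : d.degree with _ | n
  · have hd : d ≠ e := by rintro rfl; omega
    simp [MvPowerSeries.coeff_monomial, hd]
  · rw [sum_range_succ']
    have h3 : ∀ k, MvPowerSeries.monomial e a ^ (k + 1 + 1) = 0 := h2
    simp only [h3]
    simp [add_comm]

/-- The `i`-th piece of the BCH series of two elements of square zero: the terms of total degree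
`2i + 1` and `2i + 2`, without the scalar `(-1)ⁱ κᵢ`. -/
def bchPiece (e e' : σ →₀ ℕ) (a b : A) (i : ℕ) : MvPowerSeries σ A :=
  MvPowerSeries.monomial (i • (e + e') + e) ((a * b) ^ i * a) +
    MvPowerSeries.monomial (i • (e + e') + e') ((b * a) ^ i * b) +
    (1 / 2 : ℝ) • MvPowerSeries.monomial ((i + 1) • (e + e'))
      ((a * b) ^ (i + 1) - (b * a) ^ (i + 1))

/-- `log (exp a exp b)` for `a² = b² = 0`, when `a` is weighted by the monomial with exponent `e`
and `b` by the one with exponent `e'`. -/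
theorem coeff_formalLog_formalExp_mul {a b : A} (ha : a * a = 0) (hb : b * b = 0)
    {e e' : σ →₀ ℕ} (he : e.degree = 1) (he' : e'.degree = 1) (d : σ →₀ ℕ) :
    MvPowerSeries.coeff d (formalLog (formalExp (MvPowerSeries.monomial e a) *
      formalExp (MvPowerSeries.monomial e' b))) =
      ∑ i ∈ range d.degree,
        ((-1 : ℝ) ^ i * kappa i) • MvPowerSeries.coeff d (bchPiece e e' a b i) := by
  classical
  set x := MvPowerSeries.monomial e a with hxdef
  set y := MvPowerSeries.monomial e' b with hydef
  have hx : x * x = 0 := by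
    rw [hxdef, MvPowerSeries.monomial_mul_monomial, ha, map_zero]
  have hy : y * y = 0 := by
    rw [hydef, MvPowerSeries.monomial_mul_monomial, hb, map_zero]
  have hxy : ∀ n, (x * y) ^ n = MvPowerSeries.monomial (n • (e + e')) ((a * b) ^ n) :=
    monomial_mul_pow_mul e e' a b
  have hyx : ∀ n, (y * x) ^ n = MvPowerSeries.monomial (n • (e + e')) ((b * a) ^ n) := by
    intro n; rw [add_comm]; exact monomial_mul_pow_mul e' e b a n
  let l : MvPowerSeries σ A →ₗ[ℝ] A :=
    { toFun := MvPowerSeries.coeff d, map_add' := map_add _, map_smul' := fun _ _ => rfl }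
  have hl : ∀ f, l f = MvPowerSeries.coeff d f := fun _ => rfl
  have hdeg : ∀ n : ℕ, (n • (e + e')).degree = 2 * n := by
    intro n; rw [map_nsmul, map_add, he, he']; simp [mul_comm]
  have hmon : ∀ (ε : σ →₀ ℕ) (c : A), d.degree < ε.degree →
      MvPowerSeries.coeff d (MvPowerSeries.monomial ε c) = 0 := by
    intro ε c hε
    rw [MvPowerSeries.coeff_monomial, if_neg]
    rintro rfl
    exact lt_irrefl _ hε
  have hP : ∀ i, (x * y + y * x) ^ i * (x + y + x * y) - (1 / 2 : ℝ) • (x * y + y * x) ^ (i + 1) =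
      bchPiece e e' a b i := by
    intro i
    rw [add_pow_mul_eq hx hy, add_pow_succ_eq hx hy, bchPiece, hxy, hxy, hyx, hyx, hxdef, hydef,
      MvPowerSeries.monomial_mul_monomial, MvPowerSeries.monomial_mul_monomial, map_sub]
    module
  rw [formalExp_monomial ha he, formalExp_monomial hb he']
  have hu : (1 + x) * (1 + y) - 1 = x + y + x * y := by noncomm_ring
  change ∑ k ∈ Icc 1 d.degree, _ = _
  rw [hu]
  have hlog := sum_log_eq (sq_one_add_mul_one_add_sub_one hx hy) l (N := d.degree) ?_ ?_
  · simp_rw [hP] at hlog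
    simp_rw [← hl]
    rw [← hlog,
      show Icc 1 d.degree = Ico (0 + 1) (d.degree + 1) from rfl, ← sum_Ico_add', ← range_eq_Ico]
    refine sum_congr rfl fun m _ => ?_
    rw [pow_add _ _ (1 + 1)]
    simp
  · intro i hi
    rw [hl, add_pow_mul_eq hx hy, hxy, hyx, hxy, hxdef, hydef,
      MvPowerSeries.monomial_mul_monomial, MvPowerSeries.monomial_mul_monomial, map_add, map_add,
      hmon, hmon, hmon, add_zero, add_zero]
    · rw [hdeg]; omega
    · rw [map_add, hdeg]; omega
    · rw [map_add, hdeg]; omega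
  · intro i hi
    rw [hl, add_pow_succ_eq hx hy, hxy, hyx, map_add, hmon, hmon, add_zero] <;>
    · rw [hdeg]; omega

section Evaluate

variable {e e' : σ →₀ ℕ} {l : MvPowerSeries σ A →ₗ[ℝ] A} {n : ℕ}

/-- Evaluation of the pieces under a functional `l` that extracts total degree `n`. -/
theorem apply_bchPiece
    (hl : ∀ (ε : σ →₀ ℕ) (c : A), l (MvPowerSeries.monomial ε c) = if ε.degree = n then c else 0)
    (he : e.degree = 1) (he' : e'.degree = 1) (a b : A) (i : ℕ) :
    l (bchPiece e e' a b i) =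
      (if 2 * i + 1 = n then (a * b) ^ i * a + (b * a) ^ i * b else 0) +
        if 2 * i + 2 = n then (1 / 2 : ℝ) • ((a * b) ^ (i + 1) - (b * a) ^ (i + 1)) else 0 := by
  have hdeg : ∀ n : ℕ, (n • (e + e')).degree = 2 * n := by
    intro n; rw [map_nsmul, map_add, he, he']; simp [mul_comm]
  rw [bchPiece, map_add, map_add, map_smul, hl, hl, hl, map_add, map_add, hdeg, hdeg, he, he',
    show 2 * (i + 1) = 2 * i + 2 by ring]
  split_ifs <;> simp

theorem sum_apply_bchPiece_odd {k : ℕ}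
    (hl : ∀ (ε : σ →₀ ℕ) (c : A),
      l (MvPowerSeries.monomial ε c) = if ε.degree = 2 * k + 1 then c else 0)
    (he : e.degree = 1) (he' : e'.degree = 1) (a b : A) :
    ∑ i ∈ range (2 * k + 1), ((-1 : ℝ) ^ i * kappa i) • l (bchPiece e e' a b i) =
      ((-1 : ℝ) ^ k * kappa k) • ((a * b) ^ k * a + (b * a) ^ k * b) := by
  rw [sum_eq_single k]
  · rw [apply_bchPiece hl he he', if_pos rfl, if_neg (by omega), add_zero]
  · intro i _ hi
    rw [apply_bchPiece hl he he', if_neg (by omega), if_neg (by omega), add_zero, smul_zero]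
  · intro h; simp at h; omega

theorem sum_apply_bchPiece_even {k : ℕ}
    (hl : ∀ (ε : σ →₀ ℕ) (c : A),
      l (MvPowerSeries.monomial ε c) = if ε.degree = 2 * k + 2 then c else 0)
    (he : e.degree = 1) (he' : e'.degree = 1) (a b : A) :
    ∑ i ∈ range (2 * k + 2), ((-1 : ℝ) ^ i * kappa i) • l (bchPiece e e' a b i) =
      ((-1 : ℝ) ^ k * kappa k * (1 / 2)) • ((a * b) ^ (k + 1) - (b * a) ^ (k + 1)) := by
  rw [sum_eq_single k]
  · rw [apply_bchPiece hl he he', if_neg (by omega), if_pos rfl, zero_add, smul_smul]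
  · intro i _ hi
    rw [apply_bchPiece hl he he', if_neg (by omega), if_neg (by omega), add_zero, smul_zero]
  · intro h; simp at h; omega

end Evaluate

/-- The sum of the coefficients of total degree `n` of a series in two variables. -/
def homogeneousSum (n : ℕ) : MvPowerSeries (Fin 2) A →ₗ[ℝ] A where
  toFun f := ∑ pq ∈ antidiagonal n,
    MvPowerSeries.coeff (Finsupp.single 0 pq.1 + Finsupp.single 1 pq.2) f
  map_add' f g := by simp [sum_add_distrib]
  map_smul' c f := by simp [smul_sum]

theorem homogeneousSum_monomial (n : ℕ) (ε : Fin 2 →₀ ℕ) (c : A) :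
    homogeneousSum n (MvPowerSeries.monomial ε c) = if ε.degree = n then c else 0 := by
  classical
  change ∑ pq ∈ antidiagonal n, _ = _
  have hε : ε.degree = ε 0 + ε 1 := by
    rw [Finsupp.degree_eq_sum]; simp
  have h : ∀ pq : ℕ × ℕ, (Finsupp.single 0 pq.1 + Finsupp.single 1 pq.2 = ε) ↔ (ε 0, ε 1) = pq := by
    rintro ⟨p, q⟩
    constructor
    · rintro rfl; simp
    · intro h
      rw [Prod.mk.injEq] at h
      ext j
      fin_cases j <;> simp [h.1, h.2]
  simp only [MvPowerSeries.coeff_monomial, h]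
  rw [sum_ite_eq]
  simp only [HasAntidiagonal.mem_antidiagonal, hε]

theorem bchTerm_eq_sum {a b : A} (ha : a * a = 0) (hb : b * b = 0) (n : ℕ) :
    bchTerm n a b = ∑ i ∈ range n, ((-1 : ℝ) ^ i * kappa i) •
      homogeneousSum n (bchPiece (Finsupp.single (0 : Fin 2) 1) (Finsupp.single 1 1) a b i) := by
  simp only [homogeneousSum, LinearMap.coe_mk, AddHom.coe_mk, smul_sum]
  rw [sum_comm, bchTerm]
  refine sum_congr rfl fun pq hpq => ?_
  rw [bchPart, bchSeries, coeff_formalLog_formalExp_mul ha hb (by simp) (by simp)]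
  congr 2
  rw [← HasAntidiagonal.mem_antidiagonal.1 hpq]
  simp

/-- The closed form of the BCH series for `a² = b² = 0`. -/
theorem bchTerm_odd {a b : A} (ha : a * a = 0) (hb : b * b = 0) (k : ℕ) :
    bchTerm (2 * k + 1) a b =
      ((-1 : ℝ) ^ k * kappa k) • ((a * b) ^ k * a + (b * a) ^ k * b) := by
  rw [bchTerm_eq_sum ha hb]
  exact sum_apply_bchPiece_odd (homogeneousSum_monomial _) (by simp) (by simp) a b

theorem bchTerm_even {a b : A} (ha : a * a = 0) (hb : b * b = 0) (k : ℕ) :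
    bchTerm (2 * k + 2) a b =
      ((-1 : ℝ) ^ k * kappa k * (1 / 2)) • ((a * b) ^ (k + 1) - (b * a) ^ (k + 1)) := by
  rw [bchTerm_eq_sum ha hb]
  exact sum_apply_bchPiece_even (homogeneousSum_monomial _) (by simp) (by simp) a b

theorem bchTerm_zero {a b : A} (ha : a * a = 0) (hb : b * b = 0) : bchTerm 0 a b = 0 := by
  rw [bchTerm_eq_sum ha hb, range_zero, sum_empty]

/-- The closed form of the BCH series for `a² = b² = 0`, with a single grading variable. -/
theorem coeff_formalLog_odd {a b : A} (ha : a * a = 0) (hb : b * b = 0) (k : ℕ) :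
    PowerSeries.coeff (2 * k + 1) (formalLog (formalExp (PowerSeries.monomial 1 a) *
      formalExp (PowerSeries.monomial 1 b)) : PowerSeries A) =
      ((-1 : ℝ) ^ k * kappa k) • ((a * b) ^ k * a + (b * a) ^ k * b) := by
  classical
  have h := coeff_formalLog_formalExp_mul ha hb (e := Finsupp.single () 1)
    (e' := Finsupp.single () 1) (by simp) (by simp) (Finsupp.single () (2 * k + 1))
  refine h.trans ?_
  let l : MvPowerSeries Unit A →ₗ[ℝ] A :=
    { toFun := MvPowerSeries.coeff (Finsupp.single () (2 * k + 1)), map_add' := map_add _,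
      map_smul' := fun _ _ => rfl }
  rw [Finsupp.degree_single]
  refine sum_apply_bchPiece_odd (l := l) (fun ε c => ?_) (by simp) (by simp) a b
  change MvPowerSeries.coeff _ _ = _
  rw [MvPowerSeries.coeff_monomial]
  congr 1
  rw [eq_iff_iff, Finsupp.degree_eq_sum]
  constructor
  · rintro rfl; simp
  · intro h
    ext
    simpa using h.symm

end SquareZero

/-! ### The Lie algebra generated by two elements of square zero -/

section Commutators

variable {R : Type*} [Ring R] {x y : R}

theorem pow_mul_mul_pow_mul (x y : R) (n m : ℕ) :
    (x * y) ^ n * x * ((y * x) ^ m * y) = (x * y) ^ (n + m + 1) := by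
  rw [mul_assoc, ← mul_assoc x, ← mul_pow_mul, pow_succ, pow_add]
  noncomm_ring

theorem pow_mul_mul_pow_mul_self (hx : x * x = 0) (n m : ℕ) :
    (x * y) ^ n * x * ((x * y) ^ m * x) = 0 := by
  rw [mul_assoc, mul_pow_mul_self_eq_zero hx, mul_zero]

theorem pow_succ_mul_pow_succ (hx : x * x = 0) (n m : ℕ) :
    (y * x) ^ (n + 1) * (x * y) ^ (m + 1) = 0 := by
  rw [pow_succ' (x * y), ← mul_assoc, ← mul_assoc, pow_succ_mul_eq_zero hx, zero_mul, zero_mul]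

theorem lie_odd_odd (x y : R) (n m : ℕ) :
    ⁅(x * y) ^ n * x, (y * x) ^ m * y⁆ = (x * y) ^ (n + m + 1) - (y * x) ^ (n + m + 1) := by
  rw [Ring.lie_def, pow_mul_mul_pow_mul, pow_mul_mul_pow_mul, add_comm m n]

theorem lie_even_odd (hx : x * x = 0) (k n : ℕ) :
    ⁅(x * y) ^ (k + 1) - (y * x) ^ (k + 1), (x * y) ^ n * x⁆ =
      (x * y) ^ (k + 1 + n) * x + (x * y) ^ (k + 1 + n) * x := by
  have e1 : (y * x) ^ (k + 1) * ((x * y) ^ n * x) = 0 := by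
    rw [pow_succ, mul_assoc, mul_assoc, mul_pow_mul_self_eq_zero hx, mul_zero, mul_zero]
  have e2 : (x * y) ^ n * x * (x * y) ^ (k + 1) = 0 := by
    rw [pow_succ' _ k, mul_assoc, ← mul_assoc x, ← mul_assoc x, hx, zero_mul, zero_mul, mul_zero]
  have e3 : (x * y) ^ n * x * (y * x) ^ (k + 1) = (x * y) ^ (k + 1 + n) * x := by
    rw [mul_assoc, ← mul_pow_mul, ← mul_assoc, ← pow_add, add_comm n]
  rw [Ring.lie_def, sub_mul, mul_sub, e1, e2, e3, ← mul_assoc, ← pow_add]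
  abel

theorem lie_even_even (hx : x * x = 0) (hy : y * y = 0) (k n : ℕ) :
    ⁅(x * y) ^ (k + 1) - (y * x) ^ (k + 1), (x * y) ^ (n + 1) - (y * x) ^ (n + 1)⁆ = 0 := by
  rw [Ring.lie_def]
  simp only [sub_mul, mul_sub, pow_succ_mul_pow_succ hx, pow_succ_mul_pow_succ hy, sub_zero,
    zero_sub, sub_neg_eq_add]
  rw [← pow_add, ← pow_add, ← pow_add, ← pow_add, add_comm (n + 1)]
  abel

end Commutators

theorem genX_mul_genX : genX * genX = 0 := by
  rw [genX, ← map_mul, RingQuot.mkAlgHom_rel ℝ (SqZeroRel.sq 0), map_zero]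

theorem genY_mul_genY : genY * genY = 0 := by
  rw [genY, ← map_mul, RingQuot.mkAlgHom_rel ℝ (SqZeroRel.sq 1), map_zero]

theorem lie_oddX_oddY (n m : ℕ) : ⁅oddX n, oddY m⁆ = evenXY (n + m + 1) := lie_odd_odd _ _ n m

theorem lie_evenXY_oddX (k n : ℕ) : ⁅evenXY (k + 1), oddX n⁆ = (2 : ℝ) • oddX (k + 1 + n) := by
  rw [two_smul]
  exact lie_even_odd genX_mul_genX k n

theorem lie_oddY_evenXY (m k : ℕ) : ⁅oddY m, evenXY (k + 1)⁆ = (2 : ℝ) • oddY (k + 1 + m) := by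
  have h := lie_even_odd (y := genX) genY_mul_genY k m
  rw [two_smul, ← lie_skew, ← neg_lie, evenXY, neg_sub]
  exact h

theorem lie_oddX_oddX (n m : ℕ) : ⁅oddX n, oddX m⁆ = 0 := by
  rw [Ring.lie_def, oddX, oddX, pow_mul_mul_pow_mul_self genX_mul_genX,
    pow_mul_mul_pow_mul_self genX_mul_genX, sub_zero]

theorem lie_oddY_oddY (n m : ℕ) : ⁅oddY n, oddY m⁆ = 0 := by
  rw [Ring.lie_def, oddY, oddY, pow_mul_mul_pow_mul_self genY_mul_genY,
    pow_mul_mul_pow_mul_self genY_mul_genY, sub_zero]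

theorem lie_evenXY_evenXY (k n : ℕ) : ⁅evenXY (k + 1), evenXY (n + 1)⁆ = 0 :=
  lie_even_even genX_mul_genX genY_mul_genY k n

theorem oddX_zero : oddX 0 = genX := by simp [oddX]

theorem oddY_zero : oddY 0 = genY := by simp [oddY]

theorem oddX_mem (n : ℕ) : oddX n ∈ wslAlg := by
  have hX : genX ∈ wslAlg := LieSubalgebra.subset_lieSpan (by simp)
  have hY : genY ∈ wslAlg := LieSubalgebra.subset_lieSpan (by simp)
  induction n with
  | zero => rwa [oddX_zero]
  | succ n ih =>
    have h1 : evenXY (0 + 1) ∈ wslAlg := by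
      have h := lie_oddX_oddY 0 0
      rw [oddX_zero, oddY_zero] at h
      exact h ▸ wslAlg.lie_mem hX hY
    have h2 := wslAlg.smul_mem (1 / 2 : ℝ) (wslAlg.lie_mem h1 ih)
    rwa [lie_evenXY_oddX, smul_smul, show (1 / 2 : ℝ) * 2 = 1 by norm_num, one_smul,
      show 0 + 1 + n = n + 1 by ring] at h2

theorem oddY_mem (n : ℕ) : oddY n ∈ wslAlg := by
  have hX : genX ∈ wslAlg := LieSubalgebra.subset_lieSpan (by simp)
  have hY : genY ∈ wslAlg := LieSubalgebra.subset_lieSpan (by simp)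
  induction n with
  | zero => rwa [oddY_zero]
  | succ n ih =>
    have h1 : evenXY (0 + 1) ∈ wslAlg := by
      have h := lie_oddX_oddY 0 0
      rw [oddX_zero, oddY_zero] at h
      exact h ▸ wslAlg.lie_mem hX hY
    have h2 := wslAlg.smul_mem (1 / 2 : ℝ) (wslAlg.lie_mem ih h1)
    rwa [lie_oddY_evenXY, smul_smul, show (1 / 2 : ℝ) * 2 = 1 by norm_num, one_smul,
      show 0 + 1 + n = n + 1 by ring] at h2

theorem evenXY_mem (k : ℕ) : evenXY (k + 1) ∈ wslAlg := by
  have h := wslAlg.lie_mem (oddX_mem k) (oddY_mem 0)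
  rwa [lie_oddX_oddY] at h

theorem lie_wslVec_mem (i j : ℕ ⊕ ℕ ⊕ ℕ) :
    ⁅wslVec i, wslVec j⁆ ∈ Submodule.span ℝ (Set.range wslVec) := by
  have hX : ∀ n, oddX n ∈ Submodule.span ℝ (Set.range wslVec) := fun n =>
    Submodule.subset_span ⟨Sum.inl n, rfl⟩
  have hY : ∀ n, oddY n ∈ Submodule.span ℝ (Set.range wslVec) := fun n =>
    Submodule.subset_span ⟨Sum.inr (Sum.inl n), rfl⟩
  have hE : ∀ n, evenXY (n + 1) ∈ Submodule.span ℝ (Set.range wslVec) := fun n =>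
    Submodule.subset_span ⟨Sum.inr (Sum.inr n), rfl⟩
  rcases i with n | n | n <;> rcases j with m | m | m <;>
    simp only [wslVec, Sum.elim_inl, Sum.elim_inr]
  · rw [lie_oddX_oddX]; exact Submodule.zero_mem _
  · rw [lie_oddX_oddY]; exact hE _
  · rw [← lie_skew, lie_evenXY_oddX]; exact Submodule.neg_mem _ (Submodule.smul_mem _ _ (hX _))
  · rw [← lie_skew, lie_oddX_oddY]; exact Submodule.neg_mem _ (hE _)
  · rw [lie_oddY_oddY]; exact Submodule.zero_mem _
  · rw [lie_oddY_evenXY]; exact Submodule.smul_mem _ _ (hY _)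
  · rw [lie_evenXY_oddX]; exact Submodule.smul_mem _ _ (hX _)
  · rw [← lie_skew, lie_oddY_evenXY]; exact Submodule.neg_mem _ (Submodule.smul_mem _ _ (hY _))
  · rw [lie_evenXY_evenXY]; exact Submodule.zero_mem _

theorem span_wslVec : Submodule.span ℝ (Set.range wslVec) = wslAlg.toSubmodule := by
  apply le_antisymm
  · rw [Submodule.span_le]
    rintro _ ⟨n | n | n, rfl⟩
    · exact oddX_mem n
    · exact oddY_mem n
    · exact evenXY_mem n
  · let K : LieSubalgebra ℝ SqZeroAlg :=
      { Submodule.span ℝ (Set.range wslVec) with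
        lie_mem' := by
          intro a b ha hb
          change ⁅a, b⁆ ∈ Submodule.span ℝ (Set.range wslVec)
          change a ∈ Submodule.span ℝ (Set.range wslVec) at ha
          change b ∈ Submodule.span ℝ (Set.range wslVec) at hb
          induction ha, hb using Submodule.span_induction₂ with
          | mem_mem u v hu hv =>
            obtain ⟨i, rfl⟩ := hu
            obtain ⟨j, rfl⟩ := hv
            exact lie_wslVec_mem i j
          | zero_left => rw [zero_lie]; exact Submodule.zero_mem _
          | zero_right => rw [lie_zero]; exact Submodule.zero_mem _
          | add_left _ _ _ _ _ _ h1 h2 => rw [add_lie]; exact Submodule.add_mem _ h1 h2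
          | add_right _ _ _ _ _ _ h1 h2 => rw [lie_add]; exact Submodule.add_mem _ h1 h2
          | smul_left r _ _ _ _ h => rw [smul_lie]; exact Submodule.smul_mem _ _ h
          | smul_right r _ _ _ _ h => rw [lie_smul]; exact Submodule.smul_mem _ _ h }
    have h : wslAlg ≤ K := by
      rw [wslAlg, LieSubalgebra.lieSpan_le]
      rintro z (rfl | rfl)
      · exact Submodule.subset_span ⟨Sum.inl 0, oddX_zero⟩
      · exact Submodule.subset_span ⟨Sum.inr (Sum.inl 0), oddY_zero⟩
    exact h

/-! ### A faithful matrix representation -/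

open PowerSeries (coeff)

/-- The homomorphism out of `SqZeroAlg` given by two elements of square zero. -/
def sqZeroLift {B : Type*} [Ring B] [Algebra ℝ B] (x y : B) (hx : x * x = 0) (hy : y * y = 0) :
    SqZeroAlg →ₐ[ℝ] B :=
  RingQuot.liftAlgHom ℝ ⟨FreeAlgebra.lift ℝ ![x, y], by
    rintro _ _ ⟨i⟩
    rw [map_mul, FreeAlgebra.lift_ι_apply, map_zero]
    fin_cases i
    · exact hx
    · exact hy⟩

theorem sqZeroLift_genX {B : Type*} [Ring B] [Algebra ℝ B] (x y : B) (hx : x * x = 0)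
    (hy : y * y = 0) : sqZeroLift x y hx hy genX = x := by
  rw [sqZeroLift, genX, RingQuot.liftAlgHom_mkAlgHom_apply, FreeAlgebra.lift_ι_apply]
  rfl

theorem sqZeroLift_genY {B : Type*} [Ring B] [Algebra ℝ B] (x y : B) (hx : x * x = 0)
    (hy : y * y = 0) : sqZeroLift x y hx hy genY = y := by
  rw [sqZeroLift, genY, RingQuot.liftAlgHom_mkAlgHom_apply, FreeAlgebra.lift_ι_apply]
  rfl

/-- The representation of `SqZeroAlg` by matrices over `ℝ⟦s⟧` with `X ↦ E₁₂` and `Y ↦ s E₂₁`. -/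
def matRep : SqZeroAlg →ₐ[ℝ] Matrix (Fin 2) (Fin 2) (PowerSeries ℝ) :=
  sqZeroLift !![0, 1; 0, 0] !![0, 0; PowerSeries.X, 0]
    (by ext i j; fin_cases i <;> fin_cases j <;> simp)
    (by ext i j; fin_cases i <;> fin_cases j <;> simp)

theorem matRep_genX : matRep genX = !![0, 1; 0, 0] := sqZeroLift_genX _ _ _ _

theorem matRep_genY : matRep genY = !![0, 0; PowerSeries.X, 0] := sqZeroLift_genY _ _ _ _

theorem matRep_oddX (n : ℕ) : matRep (oddX n) = !![0, PowerSeries.X ^ n; 0, 0] := by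
  induction n with
  | zero => rw [oddX_zero, matRep_genX, pow_zero]
  | succ n ih =>
    rw [show oddX (n + 1) = genX * genY * oddX n by rw [oddX, pow_succ', mul_assoc]; rfl,
      map_mul, map_mul, ih, matRep_genX, matRep_genY]
    ext1 i j; fin_cases i <;> fin_cases j <;> simp [pow_succ']

theorem matRep_oddY (n : ℕ) : matRep (oddY n) = !![0, 0; PowerSeries.X ^ (n + 1), 0] := by
  induction n with
  | zero => rw [oddY_zero, matRep_genY, zero_add, pow_one]
  | succ n ih =>
    rw [show oddY (n + 1) = genY * genX * oddY n by rw [oddY, pow_succ', mul_assoc]; rfl,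
      map_mul, map_mul, ih, matRep_genX, matRep_genY]
    ext1 i j; fin_cases i <;> fin_cases j <;> simp [pow_succ' _ (n + 1)]

theorem matRep_evenXY (k : ℕ) :
    matRep (evenXY (k + 1)) = !![PowerSeries.X ^ (k + 1), 0; 0, -PowerSeries.X ^ (k + 1)] := by
  rw [show evenXY (k + 1) = oddX k * genY - oddY k * genX by
    rw [evenXY, pow_succ, pow_succ, ← mul_assoc, ← mul_assoc]; rfl, map_sub, map_mul, map_mul,
    matRep_oddX, matRep_oddY, matRep_genX, matRep_genY]
  simp [pow_succ]

/-- The functionals dual to the family `wslVec`: coefficients of entries of the representing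
matrix. -/
def wslDual (i : ℕ ⊕ ℕ ⊕ ℕ) : SqZeroAlg →ₗ[ℝ] ℝ :=
  Sum.elim (fun n => (coeff n) ∘ₗ Matrix.entryLinearMap ℝ (PowerSeries ℝ) 0 1)
    (Sum.elim (fun n => (coeff (n + 1)) ∘ₗ Matrix.entryLinearMap ℝ (PowerSeries ℝ) 1 0)
      fun n => (coeff (n + 1)) ∘ₗ Matrix.entryLinearMap ℝ (PowerSeries ℝ) 0 0) i ∘ₗ
    matRep.toLinearMap

theorem wslDual_wslVec (i j : ℕ ⊕ ℕ ⊕ ℕ) : wslDual i (wslVec j) = if i = j then 1 else 0 := by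
  rcases i with n | n | n <;> rcases j with m | m | m <;>
    simp [wslDual, wslVec, matRep_oddX, matRep_oddY, matRep_evenXY, PowerSeries.coeff_X_pow]

theorem linearIndependent_wslVec : LinearIndependent ℝ wslVec := by
  apply LinearIndependent.of_pairwise_dual_eq_zero_one wslVec wslDual
  · intro i j hij
    simp [wslDual_wslVec, hij]
  · intro i
    simp [wslDual_wslVec]

theorem linearIndependent_matRep_wslVec : LinearIndependent ℝ (matRep ∘ wslVec) := by
  have h : ∀ i, ∃ f : Matrix (Fin 2) (Fin 2) (PowerSeries ℝ) →ₗ[ℝ] ℝ,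
      f ∘ₗ matRep.toLinearMap = wslDual i := fun i => ⟨_, rfl⟩
  choose f hf using h
  have hfv : ∀ i j, f i (matRep (wslVec j)) = if i = j then 1 else 0 := fun i j => by
    rw [← wslDual_wslVec, ← hf]; rfl
  apply LinearIndependent.of_pairwise_dual_eq_zero_one _ f
  · intro i j hij
    simp [hfv, hij]
  · intro i
    simp [hfv]

/-- The representation is faithful on `wsl₂^alg`, as it keeps the family `wslVec` linearly
independent. -/
theorem matRep_injOn_wslAlg {a : SqZeroAlg} (ha : a ∈ wslAlg) (h : matRep a = 0) : a = 0 := by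
  have ha' : a ∈ Submodule.span ℝ (Set.range wslVec) := by rw [span_wslVec]; exact ha
  obtain ⟨c, rfl⟩ := (Finsupp.mem_span_range_iff_exists_finsupp).1 ha'
  have h2 : Finsupp.linearCombination ℝ (matRep ∘ wslVec) c = 0 := by
    rw [← h, Finsupp.linearCombination_apply, Finsupp.sum, Finsupp.sum, map_sum]
    simp
  rw [linearIndependent_iff.1 linearIndependent_matRep_wslVec c h2]
  simp

/-! ### The embedding into the completion -/

/-- The elements of `wsl₂¹` as matrices over `ℝ⟦s⟧`, compatibly with `matRep`. -/
def wslMat : Wsl →ₗ⁅ℝ⁆ Matrix (Fin 2) (Fin 2) (PowerSeries ℝ) where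
  toFun z := !![PowerSeries.X * z.d, z.b; PowerSeries.X * z.c, -(PowerSeries.X * z.d)]
  map_add' z w := by
    ext1 i j; fin_cases i <;> fin_cases j <;> simp [mul_add]; ring
  map_smul' r z := by
    ext1 i j; fin_cases i <;> fin_cases j <;> simp
  map_lie' {z w} := by
    rw [Ring.lie_def]
    ext1 i j; fin_cases i <;> fin_cases j <;> simp [PowerSeries.smul_eq_C_mul, map_ofNat] <;>
      ring

theorem wslMat_apply (z : Wsl) :
    wslMat z = !![PowerSeries.X * z.d, z.b; PowerSeries.X * z.c, -(PowerSeries.X * z.d)] := rfl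

theorem wslMat_injective : Function.Injective wslMat := by
  intro z w h
  rw [wslMat_apply, wslMat_apply] at h
  have h00 := congrFun (congrFun h 0) 0
  have h01 := congrFun (congrFun h 0) 1
  have h10 := congrFun (congrFun h 1) 0
  simp at h00 h01 h10
  exact Wsl.ext h01 h10 h00

/-- The element of `wsl₂¹` with given coefficient series. -/
def Wsl.mk (b c d : PowerSeries ℝ) (hb : WSummable b) (hc : WSummable c) (hd : WSummable d) : Wsl :=
  ⟨(b, c, d), hb, hc, hd⟩

@[simp] theorem Wsl.b_mk (b c d : PowerSeries ℝ) (hb : WSummable b) (hc : WSummable c)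
    (hd : WSummable d) : (Wsl.mk b c d hb hc hd).b = b := rfl
@[simp] theorem Wsl.c_mk (b c d : PowerSeries ℝ) (hb : WSummable b) (hc : WSummable c)
    (hd : WSummable d) : (Wsl.mk b c d hb hc hd).c = c := rfl
@[simp] theorem Wsl.d_mk (b c d : PowerSeries ℝ) (hb : WSummable b) (hc : WSummable c)
    (hd : WSummable d) : (Wsl.mk b c d hb hc hd).d = d := rfl

theorem WSummable.X_pow (n : ℕ) : WSummable (PowerSeries.X ^ n : PowerSeries ℝ) := by
  refine summable_of_ne_finset_zero (s := {n}) fun m hm => ?_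
  rw [PowerSeries.coeff_X_pow, if_neg (by simpa using hm)]
  simp

theorem wNorm_X_pow (n : ℕ) : wNorm (PowerSeries.X ^ n : PowerSeries ℝ) = (1 / 2) ^ n := by
  rw [wNorm, tsum_eq_single n]
  · simp
  · intro m hm
    rw [PowerSeries.coeff_X_pow, if_neg hm]
    simp

/-- The matrices that come from `wsl₂¹` form a Lie subalgebra containing the images of `X` and `Y`,
hence the image of all of `wsl₂^alg`. -/
theorem exists_wslMat_eq (a : wslAlg) : ∃ z : Wsl, wslMat z = matRep a := by
  have h : wslAlg ≤ wslMat.range.comap (AlgHom.toLieHom matRep) := by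
    rw [wslAlg, LieSubalgebra.lieSpan_le]
    rintro z (rfl | rfl)
    · refine ⟨Wsl.mk 1 0 0 (by simpa using WSummable.X_pow 0) WSummable.zero WSummable.zero, ?_⟩
      change wslMat _ = matRep genX
      rw [matRep_genX, wslMat_apply]
      simp
    · refine ⟨Wsl.mk 0 1 0 WSummable.zero (by simpa using WSummable.X_pow 0) WSummable.zero, ?_⟩
      change wslMat _ = matRep genY
      rw [matRep_genY, wslMat_apply]
      simp
  obtain ⟨z, hz⟩ := h a.2
  exact ⟨z, hz⟩

/-- The embedding of `wsl₂^alg` into its completion `wsl₂¹`. -/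
def wslEmb : wslAlg →ₗ⁅ℝ⁆ Wsl where
  toFun a := (exists_wslMat_eq a).choose
  map_add' a b := wslMat_injective (by
    rw [map_add, (exists_wslMat_eq _).choose_spec, (exists_wslMat_eq _).choose_spec,
      (exists_wslMat_eq _).choose_spec]
    simp)
  map_smul' r a := wslMat_injective (by
    rw [map_smul, (exists_wslMat_eq _).choose_spec, (exists_wslMat_eq _).choose_spec]
    simp)
  map_lie' {a b} := wslMat_injective (by
    rw [LieHom.map_lie, (exists_wslMat_eq _).choose_spec, (exists_wslMat_eq _).choose_spec,
      (exists_wslMat_eq _).choose_spec]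
    exact (AlgHom.toLieHom matRep).map_lie (a : SqZeroAlg) b)

theorem wslMat_wslEmb (a : wslAlg) : wslMat (wslEmb a) = matRep a :=
  (exists_wslMat_eq a).choose_spec

theorem wslEmb_injective : Function.Injective wslEmb := by
  rw [injective_iff_map_eq_zero]
  intro a ha
  have h := wslMat_wslEmb a
  rw [ha, map_zero] at h
  exact Subtype.ext (matRep_injOn_wslAlg a.2 h.symm)

theorem wslEmb_eq_of_matRep_eq {a : wslAlg} {z : Wsl} (h : matRep a = wslMat z) : wslEmb a = z :=
  wslMat_injective (by rw [wslMat_wslEmb, h])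

theorem coords_wslEmb_oddX {a : wslAlg} {n : ℕ} (h : (a : SqZeroAlg) = oddX n) :
    (wslEmb a).coords = (PowerSeries.X ^ n, 0, 0) := by
  rw [wslEmb_eq_of_matRep_eq (z := Wsl.mk (PowerSeries.X ^ n) 0 0 (WSummable.X_pow n)
    WSummable.zero WSummable.zero)]
  · rfl
  · rw [h, matRep_oddX, wslMat_apply]
    simp

theorem coords_wslEmb_oddY {a : wslAlg} {n : ℕ} (h : (a : SqZeroAlg) = oddY n) :
    (wslEmb a).coords = (0, PowerSeries.X ^ n, 0) := by
  rw [wslEmb_eq_of_matRep_eq (z := Wsl.mk 0 (PowerSeries.X ^ n) 0 WSummable.zero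
    (WSummable.X_pow n) WSummable.zero)]
  · rfl
  · rw [h, matRep_oddY, wslMat_apply]
    simp [pow_succ']

theorem coords_wslEmb_evenXY {a : wslAlg} {n : ℕ} (h : (a : SqZeroAlg) = evenXY (n + 1)) :
    (wslEmb a).coords = (0, 0, PowerSeries.X ^ n) := by
  rw [wslEmb_eq_of_matRep_eq (z := Wsl.mk 0 0 (PowerSeries.X ^ n) WSummable.zero WSummable.zero
    (WSummable.X_pow n))]
  · rfl
  · rw [h, matRep_evenXY, wslMat_apply]
    simp [pow_succ']

theorem wNorm_zero : wNorm 0 = 0 := by simp [wNorm]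

theorem norm_eq_of_coords {z : Wsl} {b c d : PowerSeries ℝ} (h : z.coords = (b, c, d)) :
    ‖z‖ = wNorm b + wNorm c + wNorm d := by
  rw [Wsl.norm_def, Wsl.b, Wsl.c, Wsl.d, h]

open PowerSeries (coeff)

/-! ### The Banach–Lie algebra `wsl₂¹` -/

theorem wNorm_sub_le {f g : PowerSeries ℝ} (hf : WSummable f) (hg : WSummable g) :
    wNorm (f - g) ≤ wNorm f + wNorm g := by
  have h := wNorm_add_le hf (hg.smul (-1))
  rwa [wNorm_smul, abs_neg, abs_one, one_mul, neg_one_smul, ← sub_eq_add_neg] at h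

theorem wNorm_mul_le {f g : PowerSeries ℝ} (hf : WSummable f) (hg : WSummable g) :
    wNorm (f * g) ≤ wNorm f * wNorm g := by
  have hn : ∀ {h : PowerSeries ℝ}, WSummable h →
      Summable fun n : ℕ => ‖(1 / 2 : ℝ) ^ n * |coeff n h|‖ := by
    intro h hh
    refine Summable.congr hh fun n => ?_
    rw [Real.norm_of_nonneg (by positivity)]
  rw [wNorm, wNorm, wNorm,
    tsum_mul_tsum_eq_tsum_sum_antidiagonal_of_summable_norm (hn hf) (hn hg)]
  refine Summable.tsum_le_tsum (fun n => ?_) (hf.mul hg)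
    (summable_norm_sum_mul_antidiagonal_of_summable_norm (hn hf) (hn hg)).of_norm
  rw [PowerSeries.coeff_mul]
  calc (1 / 2 : ℝ) ^ n * |∑ p ∈ antidiagonal n, coeff p.1 f * coeff p.2 g|
      ≤ (1 / 2 : ℝ) ^ n * ∑ p ∈ antidiagonal n, |coeff p.1 f * coeff p.2 g| := by
        gcongr; exact abs_sum_le_sum_abs _ _
    _ = _ := by
      rw [mul_sum]
      refine sum_congr rfl fun p hp => ?_
      rw [← HasAntidiagonal.mem_antidiagonal.1 hp, pow_add, abs_mul]
      ring

/-- The weight `1 / 2` of the factor `X` cancels the structure constant `2`. -/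
theorem wNorm_two_smul_X_mul_sub_le {f g h k : PowerSeries ℝ} (hf : WSummable f)
    (hg : WSummable g) (hh : WSummable h) (hk : WSummable k) :
    wNorm ((2 : ℝ) • (PowerSeries.X * (f * g - h * k))) ≤
      wNorm f * wNorm g + wNorm h * wNorm k := by
  have h1 := wNorm_mul_le WSummable.X ((hf.mul hg).sub (hh.mul hk))
  have h2 := wNorm_sub_le (hf.mul hg) (hh.mul hk)
  have h3 := wNorm_mul_le hf hg
  have h4 := wNorm_mul_le hh hk
  have hX := wNorm_X_pow 1
  rw [pow_one, pow_one] at hX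
  rw [hX] at h1
  rw [wNorm_smul, abs_two]
  linarith

theorem Wsl.norm_lie_le (z w : Wsl) : ‖⁅z, w⁆‖ ≤ ‖z‖ * ‖w‖ := by
  have h1 := wNorm_two_smul_X_mul_sub_le z.hd w.hb w.hd z.hb
  have h2 := wNorm_two_smul_X_mul_sub_le z.hc w.hd w.hc z.hd
  have h3 := wNorm_sub_le (z.hb.mul w.hc) (w.hb.mul z.hc)
  have h4 := wNorm_mul_le z.hb w.hc
  have h5 := wNorm_mul_le w.hb z.hc
  rw [Wsl.norm_def, Wsl.norm_def, Wsl.norm_def, Wsl.b_lie, Wsl.c_lie, Wsl.d_lie]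
  -- The six mixed products of component norms suffice; the three diagonal ones are dropped.
  have := mul_nonneg (wNorm_nonneg z.b) (wNorm_nonneg w.b)
  have := mul_nonneg (wNorm_nonneg z.c) (wNorm_nonneg w.c)
  have := mul_nonneg (wNorm_nonneg z.d) (wNorm_nonneg w.d)
  nlinarith

theorem memℓp_of_wSummable {f : PowerSeries ℝ} (hf : WSummable f) :
    Memℓp (fun n : ℕ => (1 / 2 : ℝ) ^ n * coeff n f) 1 := by
  refine memℓp_gen (hf.congr fun n => ?_)
  simp

/-- The sequence of weighted coefficients, in the space `ℓ¹`. -/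
def weightedSeq (f : PowerSeries ℝ) (hf : WSummable f) : lp (fun _ : ℕ => ℝ) 1 :=
  ⟨fun n => (1 / 2 : ℝ) ^ n * coeff n f, memℓp_of_wSummable hf⟩

theorem norm_weightedSeq (f : PowerSeries ℝ) (hf : WSummable f) :
    ‖weightedSeq f hf‖ = wNorm f := by
  rw [lp.norm_eq_tsum_rpow (by simp), wNorm]
  simp [weightedSeq]

theorem exists_weightedSeq_eq (v : lp (fun _ : ℕ => ℝ) 1) : ∃ f hf, weightedSeq f hf = v := by
  have hc : ∀ n, (1 / 2 : ℝ) ^ n * coeff n (PowerSeries.mk fun n => (2 : ℝ) ^ n * v n) = v n := by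
    intro n
    rw [PowerSeries.coeff_mk, ← mul_assoc, ← mul_pow]
    norm_num
  refine ⟨PowerSeries.mk fun n => 2 ^ n * v n, ?_, ?_⟩
  · have h := (lp.memℓp v).summable (by simp)
    refine h.congr fun n => ?_
    rw [← hc n]
    simp
  · ext n
    exact hc n

/-- The identification of `wsl₂¹` with an `ℓ¹` direct sum of three copies of `ℓ¹`. -/
def Wsl.toL1 : Wsl →+ WithLp 1 (lp (fun _ : ℕ => ℝ) 1 ×
    WithLp 1 (lp (fun _ : ℕ => ℝ) 1 × lp (fun _ : ℕ => ℝ) 1)) where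
  toFun z := WithLp.toLp 1 (weightedSeq z.b z.hb,
    WithLp.toLp 1 (weightedSeq z.c z.hc, weightedSeq z.d z.hd))
  map_zero' := by
    have h : weightedSeq 0 WSummable.zero = 0 := by ext n; simp [weightedSeq]
    change WithLp.toLp 1 (weightedSeq 0 _, WithLp.toLp 1 (weightedSeq 0 _, weightedSeq 0 _)) = 0
    rw [h]
    rfl
  map_add' z w := by
    have h : ∀ (f g : PowerSeries ℝ) (hf : WSummable f) (hg : WSummable g),
        weightedSeq (f + g) (hf.add hg) = weightedSeq f hf + weightedSeq g hg := by
      intro f g hf hg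
      ext n
      change (1 / 2 : ℝ) ^ n * coeff n (f + g) = (1 / 2) ^ n * coeff n f + (1 / 2) ^ n * coeff n g
      rw [map_add, mul_add]
    change WithLp.toLp 1 (weightedSeq (z.b + w.b) _,
      WithLp.toLp 1 (weightedSeq (z.c + w.c) _, weightedSeq (z.d + w.d) _)) = _
    rw [h _ _ z.hb w.hb, h _ _ z.hc w.hc, h _ _ z.hd w.hd]
    rfl

instance : CompleteSpace Wsl := by
  have hiso : Isometry Wsl.toL1 := by
    refine AddMonoidHomClass.isometry_of_norm _ fun z => ?_
    rw [WithLp.prod_norm_eq_of_L1, WithLp.prod_norm_eq_of_L1, Wsl.norm_def,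
      ← norm_weightedSeq _ z.hb, ← norm_weightedSeq _ z.hc, ← norm_weightedSeq _ z.hd, add_assoc]
    rfl
  rw [hiso.isUniformInducing.completeSpace_congr]
  · infer_instance
  · intro v
    obtain ⟨b, hb, h1⟩ := exists_weightedSeq_eq v.fst
    obtain ⟨c, hc, h2⟩ := exists_weightedSeq_eq v.snd.fst
    obtain ⟨d, hd, h3⟩ := exists_weightedSeq_eq v.snd.snd
    refine ⟨Wsl.mk b c d hb hc hd, ?_⟩
    change WithLp.toLp 1 (weightedSeq b hb, WithLp.toLp 1 (weightedSeq c hc, weightedSeq d hd)) = v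
    rw [h1, h2, h3]
    rfl

theorem tendsto_wNorm_sub_sum {f : PowerSeries ℝ} (hf : WSummable f) :
    Tendsto (fun N => wNorm (f - ∑ n ∈ range N, coeff n f • PowerSeries.X ^ n)) atTop (𝓝 0) := by
  have h := tendsto_sum_nat_add fun n : ℕ => (1 / 2 : ℝ) ^ n * |coeff n f|
  refine h.congr fun N => ?_
  have hc : ∀ m, coeff m (f - ∑ n ∈ range N, coeff n f • (PowerSeries.X : PowerSeries ℝ) ^ n) =
      if m < N then 0 else coeff m f := by
    intro m
    rw [map_sub, map_sum]
    simp only [map_smul, PowerSeries.coeff_X_pow, smul_eq_mul, mul_ite, mul_one, mul_zero,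
      sum_ite_eq, mem_range]
    split_ifs <;> simp
  have hs : Summable fun m : ℕ => (1 / 2 : ℝ) ^ m * |if m < N then 0 else coeff m f| := by
    refine Summable.of_nonneg_of_le (fun n => by positivity) (fun n => ?_) hf
    split_ifs
    · simp
    · rfl
  rw [wNorm]
  simp only [hc]
  rw [← hs.sum_add_tsum_nat_add N, sum_eq_zero, zero_add]
  · simp
  · intro m hm
    rw [if_pos (mem_range.1 hm)]
    simp

theorem wslEmb_denseRange : DenseRange wslEmb := by
  intro z
  let ox : ℕ → wslAlg := fun n => ⟨oddX n, oddX_mem n⟩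
  let oy : ℕ → wslAlg := fun n => ⟨oddY n, oddY_mem n⟩
  let ev : ℕ → wslAlg := fun n => ⟨evenXY (n + 1), evenXY_mem n⟩
  -- The truncations of the three coefficient sequences.
  let a : ℕ → wslAlg := fun N => ∑ n ∈ range N,
    (coeff n z.b • ox n + coeff n z.c • oy n + coeff n z.d • ev n)
  have hcoords : ∀ N, (wslEmb (a N)).coords = (∑ n ∈ range N, coeff n z.b • PowerSeries.X ^ n,
      ∑ n ∈ range N, coeff n z.c • PowerSeries.X ^ n,
      ∑ n ∈ range N, coeff n z.d • PowerSeries.X ^ n) := by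
    intro N
    have h : ∀ n, (wslEmb (coeff n z.b • ox n + coeff n z.c • oy n + coeff n z.d • ev n)).coords =
        (coeff n z.b • PowerSeries.X ^ n, coeff n z.c • PowerSeries.X ^ n,
          coeff n z.d • PowerSeries.X ^ n) := by
      intro n
      have e1 := coords_wslEmb_oddX (a := ox n) rfl
      have e2 := coords_wslEmb_oddY (a := oy n) rfl
      have e3 := coords_wslEmb_evenXY (a := ev n) rfl
      simp only [map_add, map_smul, e1, e2, e3]
      simp
    rw [show a N = _ from rfl, map_sum, map_sum, sum_congr rfl fun n _ => h n]
    ext1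
    · simp [Prod.fst_sum]
    · ext1 <;> simp [Prod.fst_sum, Prod.snd_sum]
  refine mem_closure_of_tendsto (f := fun N => wslEmb (a N)) (b := atTop) ?_
    (Eventually.of_forall fun N => ⟨a N, rfl⟩)
  rw [tendsto_iff_norm_sub_tendsto_zero]
  have hlim := ((tendsto_wNorm_sub_sum z.hb).add (tendsto_wNorm_sub_sum z.hc)).add
    (tendsto_wNorm_sub_sum z.hd)
  rw [add_zero, add_zero] at hlim
  refine hlim.congr fun N => ?_
  rw [norm_sub_rev, norm_eq_of_coords (b := z.b - _) (c := z.c - _) (d := z.d - _)]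
  rw [map_sub, hcoords]
  rfl

/-! ### Size of the coefficients -/

theorem kappa_pos (k : ℕ) : 0 < kappa k := by
  rw [kappa]; positivity

theorem kappa_zero : kappa 0 = 1 := by simp [kappa]

theorem kappa_succ (k : ℕ) : kappa (k + 1) = kappa k * ((k + 1) / (2 * (2 * k + 3))) := by
  rw [kappa, kappa, show 2 * (k + 1) + 1 = 2 * k + 1 + 1 + 1 by ring,
    Nat.factorial_succ (2 * k + 1 + 1), Nat.factorial_succ (2 * k + 1), Nat.factorial_succ k]
  have : ((2 * k + 1).factorial : ℝ) ≠ 0 := by positivity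
  push_cast
  field_simp
  ring

/-- The coefficients `4ᵏ κₖ` of the Taylor series of `arcsin x / √(1 - x²)`. -/
def kappaFour (k : ℕ) : ℝ := 4 ^ k * kappa k

theorem kappaFour_pos (k : ℕ) : 0 < kappaFour k := mul_pos (by positivity) (kappa_pos k)

theorem kappaFour_zero : kappaFour 0 = 1 := by simp [kappaFour, kappa_zero]

theorem kappaFour_succ (k : ℕ) : (2 * k + 3) * kappaFour (k + 1) = (2 * k + 2) * kappaFour k := by
  rw [kappaFour, kappaFour, kappa_succ, pow_succ]
  field_simp
  ring

theorem kappaFour_le_one (k : ℕ) : kappaFour k ≤ 1 := by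
  induction k with
  | zero => rw [kappaFour_zero]
  | succ k ih =>
    have h := kappaFour_succ k
    have hp := kappaFour_pos (k + 1)
    have hk := kappaFour_pos k
    have hn : (0 : ℝ) ≤ k := by positivity
    nlinarith

/-- This lower bound makes the series diverge like the harmonic series at `|t| = 2√2`. -/
theorem one_le_mul_kappaFour (k : ℕ) : 1 ≤ (2 * k + 1) * kappaFour k := by
  induction k with
  | zero => simp [kappaFour_zero]
  | succ k ih =>
    have h := kappaFour_succ k
    have hk := kappaFour_pos k
    push_cast
    rw [show (2 * ((k : ℝ) + 1) + 1) = 2 * k + 3 by ring, h]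
    linarith

theorem kappa_mul_half_pow_mul_pow (k : ℕ) (t : ℝ) :
    kappa k * (1 / 2) ^ k * t ^ (2 * k) = kappaFour k * (t ^ 2 / 8) ^ k := by
  rw [kappaFour, pow_mul, mul_comm (4 ^ k), mul_assoc, mul_assoc, ← mul_pow, ← mul_pow]
  congr 2
  ring

theorem summable_kappa {t : ℝ} (ht : t ^ 2 < 8) :
    Summable fun k : ℕ => kappa k * (1 / 2) ^ k * t ^ (2 * k) := by
  simp only [kappa_mul_half_pow_mul_pow]
  refine Summable.of_nonneg_of_le (fun k => ?_) (fun k => ?_)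
    (summable_geometric_of_lt_one (r := t ^ 2 / 8) (by positivity) (by linarith))
  · have := kappaFour_pos k; positivity
  · exact mul_le_of_le_one_left (by positivity) (kappaFour_le_one k)

theorem not_summable_kappa {t : ℝ} (ht : 8 ≤ t ^ 2) :
    ¬ Summable fun k : ℕ => kappa k * (1 / 2) ^ k * t ^ (2 * k) := by
  simp only [kappa_mul_half_pow_mul_pow]
  intro h
  have h1 : Summable fun k : ℕ => 1 / ((k + 1 : ℕ) : ℝ) := by
    refine Summable.of_nonneg_of_le (fun k => by positivity) (fun k => ?_) (h.mul_left 2)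
    have h2 : 1 ≤ (t ^ 2 / 8) ^ k := one_le_pow₀ (by linarith)
    have h3 := one_le_mul_kappaFour k
    have h4 := kappaFour_pos k
    rw [div_le_iff₀ (by positivity)]
    push_cast
    have h5 : kappaFour k ≤ kappaFour k * (t ^ 2 / 8) ^ k := le_mul_of_one_le_right h4.le h2
    have h6 : (0 : ℝ) ≤ k := by positivity
    nlinarith
  exact Real.not_summable_one_div_natCast ((summable_nat_add_iff 1).1 h1)

theorem sq_lt_eight {t : ℝ} (h : |t| < 2 * √2) : t ^ 2 < 8 := by
  rw [← sq_abs]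
  have h2 : √2 ^ 2 = (2 : ℝ) := Real.sq_sqrt (by norm_num)
  nlinarith [abs_nonneg t]

theorem eight_le_sq {t : ℝ} (h : 2 * √2 ≤ |t|) : 8 ≤ t ^ 2 := by
  rw [← sq_abs]
  have h2 : √2 ^ 2 = (2 : ℝ) := Real.sq_sqrt (by norm_num)
  nlinarith [Real.sqrt_nonneg 2]

theorem eight_lt_sq {t : ℝ} (h : 2 * √2 < |t|) : 8 < t ^ 2 := by
  rw [← sq_abs]
  have h2 : √2 ^ 2 = (2 : ℝ) := Real.sq_sqrt (by norm_num)
  nlinarith [Real.sqrt_nonneg 2]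

/-- From `|t| = 2√2` on, the coefficients of the `X^{(2k+1)}` in `BCH(tX, tY)` are not those of an
element of `wsl₂¹`. -/
theorem not_wSummable {t : ℝ} (ht : 8 ≤ t ^ 2) {f : PowerSeries ℝ}
    (hf : ∀ k, coeff k f = (-1) ^ k * kappa k * t ^ (2 * k + 1)) : ¬ WSummable f := by
  intro h
  have ht0 : |t| ≠ 0 := by
    intro h0
    rw [abs_eq_zero] at h0
    rw [h0] at ht
    norm_num at ht
  refine not_summable_kappa ht ((h.mul_left |t|⁻¹).congr fun k => ?_)
  rw [hf, abs_mul, abs_mul, abs_pow, abs_neg, abs_one, one_pow, one_mul, abs_of_pos (kappa_pos k),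
    pow_succ, abs_mul, abs_of_nonneg (Even.pow_nonneg (even_two_mul k) t)]
  field_simp

/-! ### The BCH series in `wsl₂¹` -/

section BchWsl

variable (t : ℝ)

theorem smul_mul_smul_pow_mul {A : Type*} [Ring A] [Algebra ℝ A] (a b : A) (k : ℕ) :
    ((t • a) * (t • b)) ^ k * (t • a) = t ^ (2 * k + 1) • ((a * b) ^ k * a) := by
  rw [smul_mul_smul_comm, smul_pow, smul_mul_smul_comm, ← pow_two, ← pow_mul, ← pow_succ]

theorem smul_mul_smul_pow {A : Type*} [Ring A] [Algebra ℝ A] (a b : A) (k : ℕ) :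
    ((t • a) * (t • b)) ^ k = t ^ (2 * k) • (a * b) ^ k := by
  rw [smul_mul_smul_comm, smul_pow, ← pow_two, ← pow_mul]

theorem smul_mul_smul_eq_zero {A : Type*} [Ring A] [Algebra ℝ A] {a : A} (ha : a * a = 0) :
    (t • a) * (t • a) = 0 := by
  rw [smul_mul_smul_comm, ha, smul_zero]

theorem bchTerm_smul_odd {A : Type*} [Ring A] [Algebra ℝ A] {a b : A} (ha : a * a = 0)
    (hb : b * b = 0) (k : ℕ) : bchTerm (2 * k + 1) (t • a) (t • b) =
      ((-1) ^ k * kappa k * t ^ (2 * k + 1)) • ((a * b) ^ k * a + (b * a) ^ k * b) := by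
  rw [bchTerm_odd (smul_mul_smul_eq_zero t ha) (smul_mul_smul_eq_zero t hb),
    smul_mul_smul_pow_mul, smul_mul_smul_pow_mul, ← smul_add, smul_smul]

theorem bchTerm_smul_even {A : Type*} [Ring A] [Algebra ℝ A] {a b : A} (ha : a * a = 0)
    (hb : b * b = 0) (k : ℕ) : bchTerm (2 * k + 2) (t • a) (t • b) =
      ((-1) ^ k * kappa k * t ^ (2 * k + 2) * (1 / 2)) •
        ((a * b) ^ (k + 1) - (b * a) ^ (k + 1)) := by
  rw [bchTerm_even (smul_mul_smul_eq_zero t ha) (smul_mul_smul_eq_zero t hb),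
    smul_mul_smul_pow, smul_mul_smul_pow, ← smul_sub, smul_smul]
  congr 1
  ring

theorem bchTerm_gen_odd (k : ℕ) : bchTerm (2 * k + 1) (t • genX) (t • genY) =
    ((-1) ^ k * kappa k * t ^ (2 * k + 1)) • (oddX k + oddY k) :=
  bchTerm_smul_odd t genX_mul_genX genY_mul_genY k

theorem bchTerm_gen_even (k : ℕ) : bchTerm (2 * k + 2) (t • genX) (t • genY) =
    ((-1) ^ k * kappa k * t ^ (2 * k + 2) * (1 / 2)) • evenXY (k + 1) :=
  bchTerm_smul_even t genX_mul_genX genY_mul_genY k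

theorem bchTerm_gen_zero : bchTerm 0 (t • genX) (t • genY) = 0 :=
  bchTerm_zero (smul_mul_smul_eq_zero t genX_mul_genX) (smul_mul_smul_eq_zero t genY_mul_genY)

theorem nat_cases_parity {p : ℕ → Prop} (h0 : p 0) (h1 : ∀ k, p (2 * k + 1))
    (h2 : ∀ k, p (2 * k + 2)) (n : ℕ) : p n := by
  obtain ⟨k, rfl | rfl⟩ := Nat.even_or_odd' n
  · rcases k with _ | k
    · exact h0
    · exact h2 k
  · exact h1 k

theorem bchTerm_gen_mem (n : ℕ) : bchTerm n (t • genX) (t • genY) ∈ wslAlg := by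
  induction n using nat_cases_parity with
  | h0 => rw [bchTerm_gen_zero]; exact wslAlg.zero_mem
  | h1 k =>
    rw [bchTerm_gen_odd]
    exact wslAlg.smul_mem _ (wslAlg.add_mem (oddX_mem k) (oddY_mem k))
  | h2 k => rw [bchTerm_gen_even]; exact wslAlg.smul_mem _ (evenXY_mem k)

/-- The homogeneous parts of `BCH(tX, tY)`, as elements of `wsl₂^alg`. -/
def bchWsl (n : ℕ) : wslAlg := ⟨bchTerm n (t • genX) (t • genY), bchTerm_gen_mem t n⟩

theorem bchWsl_zero : bchWsl t 0 = 0 := Subtype.ext (bchTerm_gen_zero t)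

theorem coords_wslEmb_bchWsl_odd (k : ℕ) : (wslEmb (bchWsl t (2 * k + 1))).coords =
    (((-1) ^ k * kappa k * t ^ (2 * k + 1)) • PowerSeries.X ^ k,
      ((-1) ^ k * kappa k * t ^ (2 * k + 1)) • PowerSeries.X ^ k, 0) := by
  have h : bchWsl t (2 * k + 1) = ((-1) ^ k * kappa k * t ^ (2 * k + 1)) •
      ((⟨oddX k, oddX_mem k⟩ : wslAlg) + ⟨oddY k, oddY_mem k⟩) :=
    Subtype.ext (bchTerm_gen_odd t k)
  rw [h, map_smul, map_add, map_smul, map_add,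
    coords_wslEmb_oddX (a := ⟨oddX k, oddX_mem k⟩) rfl,
    coords_wslEmb_oddY (a := ⟨oddY k, oddY_mem k⟩) rfl]
  simp

theorem coords_wslEmb_bchWsl_even (k : ℕ) : (wslEmb (bchWsl t (2 * k + 2))).coords =
    (0, 0, ((-1) ^ k * kappa k * t ^ (2 * k + 2) * (1 / 2)) • PowerSeries.X ^ k) := by
  have h : bchWsl t (2 * k + 2) = ((-1) ^ k * kappa k * t ^ (2 * k + 2) * (1 / 2)) •
      (⟨evenXY (k + 1), evenXY_mem k⟩ : wslAlg) :=
    Subtype.ext (bchTerm_gen_even t k)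
  rw [h, map_smul, map_smul, coords_wslEmb_evenXY (a := ⟨evenXY (k + 1), evenXY_mem k⟩) rfl]
  simp

theorem norm_wslEmb_bchWsl_odd (k : ℕ) : ‖wslEmb (bchWsl t (2 * k + 1))‖ =
    2 * |t| * (kappa k * (1 / 2) ^ k * t ^ (2 * k)) := by
  rw [norm_eq_of_coords (coords_wslEmb_bchWsl_odd t k), wNorm_smul, wNorm_zero, wNorm_X_pow,
    abs_mul, abs_mul, abs_pow, abs_neg, abs_one, one_pow, abs_of_pos (kappa_pos k), pow_succ,
    abs_mul, abs_of_nonneg (Even.pow_nonneg (even_two_mul k) t)]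
  ring

theorem norm_wslEmb_bchWsl_even (k : ℕ) : ‖wslEmb (bchWsl t (2 * k + 2))‖ =
    t ^ 2 / 2 * (kappa k * (1 / 2) ^ k * t ^ (2 * k)) := by
  rw [norm_eq_of_coords (coords_wslEmb_bchWsl_even t k), wNorm_smul, wNorm_zero, wNorm_X_pow,
    abs_mul, abs_mul, abs_mul, abs_pow, abs_neg, abs_one, one_pow, abs_of_pos (kappa_pos k),
    pow_add, abs_mul, abs_of_nonneg (Even.pow_nonneg (even_two_mul k) t), abs_sq,
    show |(1 / 2 : ℝ)| = 1 / 2 by norm_num]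
  ring

/-- Summability over `ℕ` from summability over the positive odd and even numbers. -/
theorem summable_of_odd_of_even {E : Type*} [NormedAddCommGroup E] {f : ℕ → E}
    (h1 : Summable fun k => f (2 * k + 1)) (h2 : Summable fun k => f (2 * k + 2)) :
    Summable f := by
  refine Summable.even_add_odd ?_ h1
  exact (summable_nat_add_iff 1).1 h2

theorem summable_norm_bchWsl {t : ℝ} (ht : |t| < 2 * √2) :
    Summable fun n => ‖wslEmb (bchWsl t n)‖ := by
  apply summable_of_odd_of_even
  · simp only [norm_wslEmb_bchWsl_odd]
    exact (summable_kappa (sq_lt_eight ht)).mul_left _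
  · simp only [norm_wslEmb_bchWsl_even]
    exact (summable_kappa (sq_lt_eight ht)).mul_left _

/-- The coefficient of `X^{(2k+1)}`, as a continuous functional on `wsl₂¹`. -/
def Wsl.coeffX (k : ℕ) : Wsl →L[ℝ] ℝ :=
  ((coeff k) ∘ₗ LinearMap.fst ℝ _ _ ∘ₗ Wsl.coords).mkContinuous (2 ^ k) fun z => by
    change |coeff k z.b| ≤ 2 ^ k * ‖z‖
    have h1 := z.hb.le_tsum k (fun j _ => by positivity)
    have h2 : (1 / 2 : ℝ) ^ k * |coeff k z.b| ≤ ‖z‖ := by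
      refine h1.trans ?_
      have h3 := wNorm_nonneg z.c
      have h4 := wNorm_nonneg z.d
      rw [Wsl.norm_def]
      change wNorm z.b ≤ _
      linarith
    calc |coeff k z.b| = 2 ^ k * ((1 / 2 : ℝ) ^ k * |coeff k z.b|) := by
          rw [← mul_assoc, ← mul_pow]; norm_num
      _ ≤ _ := by gcongr

theorem Wsl.coeffX_apply (k : ℕ) (z : Wsl) : Wsl.coeffX k z = coeff k z.coords.1 := rfl

theorem coeffX_bchWsl (k n : ℕ) : Wsl.coeffX k (wslEmb (bchWsl t n)) =
    if n = 2 * k + 1 then (-1) ^ k * kappa k * t ^ (2 * k + 1) else 0 := by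
  rw [Wsl.coeffX_apply]
  induction n using nat_cases_parity with
  | h0 => rw [bchWsl_zero, map_zero, map_zero]; simp
  | h1 j =>
    rw [coords_wslEmb_bchWsl_odd]
    simp only [map_smul, PowerSeries.coeff_X_pow, smul_eq_mul, mul_ite, mul_one, mul_zero]
    by_cases h : k = j
    · subst h; simp
    · rw [if_neg h, if_neg (by omega)]
  | h2 j =>
    rw [coords_wslEmb_bchWsl_even, if_neg (by omega)]
    simp

theorem not_tendsto_sum_bchWsl {t : ℝ} (ht : 2 * √2 ≤ |t|) :
    ¬ ∃ s : Wsl, Tendsto (fun N => ∑ n ∈ range N, wslEmb (bchWsl t n)) atTop (𝓝 s) := by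
  rintro ⟨s, hs⟩
  refine not_wSummable (eight_le_sq ht) (f := s.b) (fun k => ?_) s.hb
  have h1 := ((Wsl.coeffX k).continuous.tendsto s).comp hs
  refine tendsto_nhds_unique h1 (tendsto_const_nhds.congr' ?_)
  filter_upwards [eventually_ge_atTop (2 * k + 2)] with N hN
  rw [Function.comp_apply, map_sum]
  simp only [coeffX_bchWsl, sum_ite_eq', mem_range]
  rw [if_pos (by omega)]

/-- In degree `2k + 1`, a formal logarithm of `exp(tX) exp(tY)` must have the coefficients of the
BCH series, which are not summable with the weights of `wsl₂¹`. -/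
theorem not_exists_log {t : ℝ} (ht : 8 ≤ t ^ 2) :
    ¬ ∃ z : Wsl, formalExp z.toFormal =
      formalExp (PowerSeries.monomial 1 (t • genX)) *
        formalExp (PowerSeries.monomial 1 (t • genY)) := by
  rintro ⟨z, hz⟩
  have hc : MvPowerSeries.constantCoeff z.toFormal = 0 := by
    change PowerSeries.constantCoeff z.toFormal = 0
    rw [← PowerSeries.coeff_zero_eq_constantCoeff_apply, Wsl.toFormal, PowerSeries.coeff_mk]
    simp
  have hlog := formalLog_formalExp hc
  rw [hz] at hlog
  refine not_wSummable ht (f := z.b) (fun k => ?_) z.hb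
  have h1 := coeff_formalLog_odd (smul_mul_smul_eq_zero t genX_mul_genX)
    (smul_mul_smul_eq_zero t genY_mul_genY) k
  rw [← bchTerm_odd (smul_mul_smul_eq_zero t genX_mul_genX)
    (smul_mul_smul_eq_zero t genY_mul_genY), bchTerm_gen_odd] at h1
  have h2 : coeff (2 * k + 1) z.toFormal = coeff k z.b • oddX k + coeff k z.c • oddY k := by
    rw [Wsl.toFormal, PowerSeries.coeff_mk, if_pos (by omega),
      show (2 * k + 1) / 2 = k by omega]
  rw [hlog, h2] at h1
  have hX : wslDual (Sum.inl k) (oddX k) = 1 :=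
    (wslDual_wslVec (Sum.inl k) (Sum.inl k)).trans (by simp)
  have hY : wslDual (Sum.inl k) (oddY k) = 0 :=
    (wslDual_wslVec (Sum.inl k) (Sum.inr (Sum.inl k))).trans (by simp)
  have h3 := congrArg (wslDual (Sum.inl k)) h1
  rw [map_add, map_smul, map_smul, map_smul, map_add, hX, hY] at h3
  simpa using h3

end BchWsl

/-! ### The Taylor series of `arcsin x / √(1 - x²)` and `arsinh x / √(1 + x²)` -/

theorem summable_linear_mul_pow {r : ℝ} (hr : |r| < 1) :
    Summable fun k : ℕ => (2 * (k : ℝ) + 1) * (r ^ 2) ^ k := by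
  have h1 : ‖r ^ 2‖ < 1 := by
    rw [norm_pow, Real.norm_eq_abs]; exact pow_lt_one₀ (abs_nonneg r) hr two_ne_zero
  have h := ((summable_pow_mul_geometric_of_norm_lt_one 1 h1).mul_left 2).add
    (summable_pow_mul_geometric_of_norm_lt_one 0 h1)
  refine h.congr fun k => ?_
  rw [pow_one, pow_zero]
  ring

section ArcSeries

variable {ε : ℝ}

theorem norm_kappaFour_term_le (hε : |ε| ≤ 1) {r x : ℝ} (hx : |x| ≤ r) (k : ℕ) :
    ‖ε ^ k * kappaFour k * ((2 * k + 1) * x ^ (2 * k))‖ ≤ (2 * (k : ℝ) + 1) * (r ^ 2) ^ k := by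
  rw [norm_mul, norm_mul, norm_pow, norm_mul, norm_pow, Real.norm_eq_abs, Real.norm_eq_abs,
    Real.norm_eq_abs, Real.norm_eq_abs, abs_of_pos (kappaFour_pos k),
    abs_of_nonneg (by positivity : (0 : ℝ) ≤ 2 * k + 1), ← pow_mul]
  calc |ε| ^ k * kappaFour k * ((2 * k + 1) * |x| ^ (2 * k))
      ≤ 1 * 1 * ((2 * k + 1) * r ^ (2 * k)) := by
        have := kappaFour_pos k
        have h1 := kappaFour_le_one k
        have h2 : |ε| ^ k ≤ 1 := pow_le_one₀ (abs_nonneg ε) hε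
        gcongr
    _ = _ := by ring

theorem norm_kappaFour_pow_le (hε : |ε| ≤ 1) {x : ℝ} (hx : |x| < 1) (k : ℕ) :
    ‖ε ^ k * kappaFour k * x ^ (2 * k + 1)‖ ≤ (2 * (k : ℝ) + 1) * (|x| ^ 2) ^ k := by
  have h := norm_kappaFour_term_le hε (le_refl |x|) k
  refine le_trans ?_ h
  have hk : (1 : ℝ) ≤ 2 * k + 1 := by
    have : (0 : ℝ) ≤ k := by positivity
    linarith
  have h1 : ‖x ^ (2 * k + 1)‖ ≤ ‖(2 * (k : ℝ) + 1) * x ^ (2 * k)‖ := by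
    rw [pow_succ', norm_mul, norm_mul, Real.norm_of_nonneg (by positivity : (0 : ℝ) ≤ 2 * k + 1)]
    exact mul_le_mul_of_nonneg_right (hx.le.trans hk) (norm_nonneg _)
  rw [norm_mul, norm_mul _ ((2 * (k : ℝ) + 1) * x ^ (2 * k))]
  exact mul_le_mul_of_nonneg_left h1 (norm_nonneg _)

theorem summable_kappaFour_pow (hε : |ε| ≤ 1) {x : ℝ} (hx : |x| < 1) :
    Summable fun k : ℕ => ε ^ k * kappaFour k * x ^ (2 * k + 1) :=
  Summable.of_norm_bounded (summable_linear_mul_pow (by rwa [abs_abs]))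
    (norm_kappaFour_pow_le hε hx)

theorem summable_kappaFour_term (hε : |ε| ≤ 1) {x : ℝ} (hx : |x| < 1) :
    Summable fun k : ℕ => ε ^ k * kappaFour k * ((2 * k + 1) * x ^ (2 * k)) :=
  Summable.of_norm_bounded (summable_linear_mul_pow (by rwa [abs_abs]))
    (norm_kappaFour_term_le hε le_rfl)

/-- The series `h = ∑ εᵏ 4ᵏ κₖ x²ᵏ⁺¹` solves `(1 - ε x²) h' = 1 + ε x h`. -/
theorem hasDerivAt_kappaFour_series (hε : |ε| ≤ 1) {x : ℝ} (hx : |x| < 1) :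
    ∃ h', HasDerivAt (fun x => ∑' k : ℕ, ε ^ k * kappaFour k * x ^ (2 * k + 1)) h' x ∧
      (1 - ε * x ^ 2) * h' = 1 + ε * x * ∑' k : ℕ, ε ^ k * kappaFour k * x ^ (2 * k + 1) := by
  refine ⟨∑' k : ℕ, ε ^ k * kappaFour k * ((2 * k + 1) * x ^ (2 * k)), ?_, ?_⟩
  · obtain ⟨r, hxr, hr⟩ := exists_between hx
    have hr0 : 0 < r := (abs_nonneg x).trans_lt hxr
    refine hasDerivAt_tsum_of_isPreconnected (𝕜 := ℝ) (t := Set.Ioo (-r) r) (y₀ := 0)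
      (g := fun (k : ℕ) x => ε ^ k * kappaFour k * x ^ (2 * k + 1))
      (g' := fun (k : ℕ) x => ε ^ k * kappaFour k * ((2 * k + 1) * x ^ (2 * k)))
      (summable_linear_mul_pow (r := r) (by rwa [abs_of_pos hr0])) isOpen_Ioo isPreconnected_Ioo
      (fun k y _ => ?_) (fun k y hy => ?_) ⟨by linarith, hr0⟩ ?_ (abs_lt.1 hxr)
    · have h := (hasDerivAt_pow (2 * k + 1) y).const_mul (ε ^ k * kappaFour k)
      simpa using h
    · exact norm_kappaFour_term_le hε (abs_lt.2 hy).le k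
    · exact summable_kappaFour_pow hε (by simp)
  · have h1 := summable_kappaFour_term hε hx
    have h2 := summable_kappaFour_pow hε hx
    have h3 : ∀ k : ℕ, ε ^ (k + 1) * kappaFour (k + 1) *
        ((2 * (k + 1 : ℕ) + 1) * x ^ (2 * (k + 1))) =
        ε * x ^ 2 * (ε ^ k * kappaFour k * ((2 * k + 1) * x ^ (2 * k))) +
          ε * x * (ε ^ k * kappaFour k * x ^ (2 * k + 1)) := by
      intro k
      have h := kappaFour_succ k
      push_cast
      linear_combination (ε ^ (k + 1) * x ^ (2 * (k + 1))) * h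
    have h4 := h1.tsum_eq_zero_add
    rw [tsum_congr h3, (h1.mul_left (ε * x ^ 2)).tsum_add (h2.mul_left (ε * x)), tsum_mul_left,
      tsum_mul_left] at h4
    simp only [pow_zero, kappaFour_zero, CharP.cast_eq_zero, mul_zero, zero_add, mul_one] at h4
    linear_combination h4

theorem one_sub_mul_sq_pos (hε : |ε| ≤ 1) {x : ℝ} (hx : |x| < 1) : 0 < 1 - ε * x ^ 2 := by
  have h1 : x ^ 2 < 1 := by rw [← sq_abs]; exact pow_lt_one₀ (abs_nonneg x) hx two_ne_zero
  have h2 := abs_le.1 hε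
  nlinarith [sq_nonneg x]

/-- If `G` is the primitive of `1 / √(1 - ε x²)` with `G(0) = 0`, then `√(1 - ε x²) h - G` is
constant, where `h` is the series in question. -/
theorem hasSum_kappaFour (hε : |ε| ≤ 1) {G : ℝ → ℝ} (h0 : G 0 = 0)
    (hG : ∀ x, |x| < 1 → HasDerivAt G (√(1 - ε * x ^ 2))⁻¹ x) {x : ℝ} (hx : |x| < 1) :
    HasSum (fun k : ℕ => ε ^ k * kappaFour k * x ^ (2 * k + 1)) (G x / √(1 - ε * x ^ 2)) := by
  set h : ℝ → ℝ := fun x => ∑' k : ℕ, ε ^ k * kappaFour k * x ^ (2 * k + 1) with hh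
  have hF : ∀ y, |y| < 1 → HasDerivAt (fun y => √(1 - ε * y ^ 2) * h y - G y) 0 y := by
    intro y hy
    obtain ⟨h', hd, hode⟩ := hasDerivAt_kappaFour_series hε hy
    have hpos := one_sub_mul_sq_pos hε hy
    have hs : HasDerivAt (fun y : ℝ => 1 - ε * y ^ 2) (-(ε * (2 * y))) y := by
      have := ((hasDerivAt_pow 2 y).const_mul ε).const_sub 1
      simpa using this
    refine (((hs.sqrt hpos.ne').mul hd).sub (hG y hy)).congr_deriv ?_
    have hsq : √(1 - ε * y ^ 2) ^ 2 = 1 - ε * y ^ 2 := Real.sq_sqrt hpos.le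
    have hsp : 0 < √(1 - ε * y ^ 2) := Real.sqrt_pos.2 hpos
    rw [← hsq] at hode
    change _ / (2 * √(1 - ε * y ^ 2)) * h y + _ - _ = 0
    field_simp
    change _ = 1 + ε * y * h y at hode
    linear_combination hode
  have hconst : √(1 - ε * x ^ 2) * h x - G x = √(1 - ε * 0 ^ 2) * h 0 - G 0 := by
    refine isOpen_Ioo.is_const_of_deriv_eq_zero (s := Set.Ioo (-1 : ℝ) 1) isPreconnected_Ioo
      (f := fun y => √(1 - ε * y ^ 2) * h y - G y)
      (fun y hy => (hF y (abs_lt.2 hy)).differentiableAt.differentiableWithinAt)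
      (fun y hy => (hF y (abs_lt.2 hy)).deriv) (abs_lt.1 hx) (by constructor <;> norm_num)
  have hz : h 0 = 0 := by
    rw [hh]
    simp
  rw [hz, h0, mul_zero, sub_zero, sub_eq_zero] at hconst
  rw [← hconst, mul_div_cancel_left₀ _ (Real.sqrt_pos.2 (one_sub_mul_sq_pos hε hx)).ne']
  exact (summable_kappaFour_pow hε hx).hasSum

end ArcSeries

theorem hasSum_arcsin {x : ℝ} (hx : |x| < 1) :
    HasSum (fun k : ℕ => kappaFour k * x ^ (2 * k + 1)) (Real.arcsin x / √(1 - x ^ 2)) := by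
  have h := hasSum_kappaFour (ε := 1) (by simp) Real.arcsin_zero (fun y hy => ?_) hx
  · simpa using h
  · have hy' := abs_lt.1 hy
    simpa using Real.hasDerivAt_arcsin hy'.1.ne' hy'.2.ne

theorem hasSum_arsinh {x : ℝ} (hx : |x| < 1) :
    HasSum (fun k : ℕ => (-1) ^ k * kappaFour k * x ^ (2 * k + 1))
      (Real.arsinh x / √(1 + x ^ 2)) := by
  have h := hasSum_kappaFour (ε := -1) (by simp) Real.arsinh_zero (fun y _ => ?_) hx
  · simpa using h
  · simpa using Real.hasDerivAt_arsinh y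

theorem two_sqrt_two_sq : (2 * √2) ^ 2 = (8 : ℝ) := by
  rw [mul_pow, Real.sq_sqrt (by norm_num)]; norm_num

theorem kappaFour_mul_pow_eq (k : ℕ) (t : ℝ) :
    2 * √2 * (kappaFour k * (t / (2 * √2)) ^ (2 * k + 1)) =
      kappa k * (1 / 2) ^ k * t ^ (2 * k + 1) := by
  have h : (2 * √2 : ℝ) ≠ 0 := by positivity
  have hk := kappa_mul_half_pow_mul_pow k t
  rw [pow_succ t, ← mul_assoc (kappa k * _), hk, pow_succ, pow_mul (t / (2 * √2)), div_pow,
    two_sqrt_two_sq]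
  field_simp

theorem abs_div_lt_one {t : ℝ} (ht : |t| < 2 * √2) : |t / (2 * √2)| < 1 := by
  rw [abs_div, abs_of_pos (by positivity : (0 : ℝ) < 2 * √2), div_lt_one (by positivity)]
  exact ht

theorem hasSum_kappa_arcsin {t : ℝ} (ht : |t| < 2 * √2) :
    HasSum (fun k : ℕ => kappa k * (1 / 2) ^ k * t ^ (2 * k + 1))
      (8 * Real.arcsin (t / (2 * √2)) / √(8 - t ^ 2)) := by
  have h := (hasSum_arcsin (abs_div_lt_one ht)).mul_left (2 * √2)
  simp only [kappaFour_mul_pow_eq] at h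
  have h8 := sq_lt_eight ht
  have e : √(1 - (t / (2 * √2)) ^ 2) = √(8 - t ^ 2) / (2 * √2) := by
    rw [div_pow, two_sqrt_two_sq, ← Real.sqrt_sq (by positivity : (0 : ℝ) ≤ 2 * √2),
      two_sqrt_two_sq, ← Real.sqrt_div (by linarith)]
    congr 1
    ring
  have e2 : 2 * √2 * (Real.arcsin (t / (2 * √2)) / (√(8 - t ^ 2) / (2 * √2))) =
      8 * Real.arcsin (t / (2 * √2)) / √(8 - t ^ 2) := by
    rw [div_div_eq_mul_div, ← two_sqrt_two_sq]
    ring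
  rwa [e, e2] at h

theorem sqrt_one_add_div_sq (t : ℝ) : √(1 + (t / (2 * √2)) ^ 2) = √(8 + t ^ 2) / (2 * √2) := by
  rw [div_pow, two_sqrt_two_sq, ← Real.sqrt_sq (by positivity : (0 : ℝ) ≤ 2 * √2),
    two_sqrt_two_sq, ← Real.sqrt_div (by positivity)]
  congr 1
  ring

theorem hasSum_kappa_arsinh {t : ℝ} (ht : |t| < 2 * √2) :
    HasSum (fun k : ℕ => (-1) ^ k * (kappa k * (1 / 2) ^ k * t ^ (2 * k + 1)))
      (8 * Real.arsinh (t / (2 * √2)) / √(8 + t ^ 2)) := by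
  have h := (hasSum_arsinh (abs_div_lt_one ht)).mul_left (2 * √2)
  have e2 : 2 * √2 * (Real.arsinh (t / (2 * √2)) / (√(8 + t ^ 2) / (2 * √2))) =
      8 * Real.arsinh (t / (2 * √2)) / √(8 + t ^ 2) := by
    rw [div_div_eq_mul_div, ← two_sqrt_two_sq]
    ring
  rw [sqrt_one_add_div_sq, e2] at h
  simp only [← kappaFour_mul_pow_eq]
  refine h.congr_fun fun k => ?_
  ring

/-! ### The Banach–Lie algebra `sl₂` -/

theorem Sl2.mat_S (a b c : ℝ) : (Sl2.S a b c).mat = !![a, √2 * b; √2 * c, -a] := rfl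

theorem sqrt_two_mul_self : √2 * √2 = (2 : ℝ) := Real.mul_self_sqrt (by norm_num)

theorem Sl2.eq_S (z : Sl2) : z = Sl2.S (z.mat 0 0) (z.mat 0 1 / √2) (z.mat 1 0 / √2) := by
  have h := z.trace_mat
  have h2 : (√2 : ℝ) ≠ 0 := by positivity
  apply Sl2.mat_injective
  rw [Sl2.mat_S]
  ext i j
  fin_cases i <;> fin_cases j
  · rfl
  · change z.mat 0 1 = √2 * (z.mat 0 1 / √2); field_simp
  · change z.mat 1 0 = √2 * (z.mat 1 0 / √2); field_simp
  · change z.mat 1 1 = -z.mat 0 0; linarith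

theorem Sl2.norm_S (a b c : ℝ) : ‖Sl2.S a b c‖ = 2 * √(a ^ 2 + b ^ 2 + c ^ 2) := by
  have h2 : (√2 : ℝ) ≠ 0 := by positivity
  have h : Sl2.vec (Sl2.S a b c) = (2 : ℝ) • !₂[a, b, c] := by
    change (2 : ℝ) • !₂[a, √2 * b / √2, √2 * c / √2] = _
    rw [mul_div_cancel_left₀ _ h2, mul_div_cancel_left₀ _ h2]
  change ‖Sl2.vec (Sl2.S a b c)‖ = _
  rw [h, norm_smul, EuclideanSpace.norm_eq, Fin.sum_univ_three]
  simp

theorem Sl2.lie_S (a b c a' b' c' : ℝ) : ⁅Sl2.S a b c, Sl2.S a' b' c'⁆ =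
    Sl2.S (2 * (b * c' - c * b')) (2 * (a * b' - b * a')) (2 * (c * a' - a * c')) := by
  apply Sl2.mat_injective
  rw [LieHom.map_lie, Ring.lie_def, Sl2.mat_S, Sl2.mat_S, Sl2.mat_S]
  have h := sqrt_two_mul_self
  ext i j
  fin_cases i <;> fin_cases j <;> simp
  · linear_combination (b * c' - b' * c) * h
  · ring
  · ring
  · linear_combination (c * b' - c' * b) * h

/-- The bracket is twice the vector product, so the estimate is the Lagrange identity. -/
theorem Sl2.norm_lie_le (z w : Sl2) : ‖⁅z, w⁆‖ ≤ ‖z‖ * ‖w‖ := by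
  rw [Sl2.eq_S z, Sl2.eq_S w, Sl2.lie_S, Sl2.norm_S, Sl2.norm_S, Sl2.norm_S,
    mul_mul_mul_comm, ← Real.sqrt_mul (by positivity)]
  set a := z.mat 0 0
  set b := z.mat 0 1 / √2
  set c := z.mat 1 0 / √2
  set a' := w.mat 0 0
  set b' := w.mat 0 1 / √2
  set c' := w.mat 1 0 / √2
  have h4 : (2 * 2 : ℝ) = 2 * √(2 ^ 2) := by rw [Real.sqrt_sq (by norm_num)]
  rw [h4, mul_assoc, ← Real.sqrt_mul (by positivity)]
  gcongr
  nlinarith [sq_nonneg (a * a' + b * b' + c * c')]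

instance : CompleteSpace Sl2 := by
  have : FiniteDimensional ℝ Sl2 := FiniteDimensional.of_injective Sl2.vec Sl2.vec_injective
  exact FiniteDimensional.complete ℝ Sl2

theorem sl2X_mat : sl2X.mat = !![0, √2 / 2; 0, 0] := by
  rw [sl2X, Sl2.mat_S]
  ext i j
  fin_cases i <;> fin_cases j <;> simp
  ring

theorem sl2Y_mat : sl2Y.mat = !![0, 0; √2 / 2, 0] := by
  rw [sl2Y, Sl2.mat_S]
  ext i j
  fin_cases i <;> fin_cases j <;> simp
  ring

theorem norm_sl2X : ‖sl2X‖ = 1 := by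
  rw [sl2X, Sl2.norm_S, show (0 : ℝ) ^ 2 + (1 / 2) ^ 2 + 0 ^ 2 = (1 / 2) ^ 2 by ring,
    Real.sqrt_sq (by norm_num)]
  norm_num

theorem norm_sl2Y : ‖sl2Y‖ = 1 := by
  rw [sl2Y, Sl2.norm_S, show (0 : ℝ) ^ 2 + 0 ^ 2 + (1 / 2) ^ 2 = (1 / 2) ^ 2 by ring,
    Real.sqrt_sq (by norm_num)]
  norm_num

theorem sl2X_mul_sl2X : sl2X.mat * sl2X.mat = 0 := by
  rw [sl2X_mat]
  ext i j
  fin_cases i <;> fin_cases j <;> simp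

theorem sl2Y_mul_sl2Y : sl2Y.mat * sl2Y.mat = 0 := by
  rw [sl2Y_mat]
  ext i j
  fin_cases i <;> fin_cases j <;> simp

theorem sl2X_mul_sl2Y : sl2X.mat * sl2Y.mat = !![1 / 2, 0; 0, 0] := by
  have h := sqrt_two_mul_self
  rw [sl2X_mat, sl2Y_mat]
  ext i j
  fin_cases i <;> fin_cases j <;> simp
  linear_combination h / 4

theorem sl2Y_mul_sl2X : sl2Y.mat * sl2X.mat = !![0, 0; 0, 1 / 2] := by
  have h := sqrt_two_mul_self
  rw [sl2X_mat, sl2Y_mat]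
  ext i j
  fin_cases i <;> fin_cases j <;> simp
  linear_combination h / 4

theorem pow_mul_eq_smul {A : Type*} [Ring A] [Algebra ℝ A] {a b : A} {r : ℝ}
    (h : a * b * a = r • a) (k : ℕ) : (a * b) ^ k * a = r ^ k • a := by
  induction k with
  | zero => simp
  | succ k ih => rw [pow_succ, mul_assoc, h, mul_smul_comm, ih, smul_smul, pow_succ']

theorem sl2_pow_mul_sl2X (k : ℕ) :
    (sl2X.mat * sl2Y.mat) ^ k * sl2X.mat = (1 / 2 : ℝ) ^ k • sl2X.mat := by
  apply pow_mul_eq_smul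
  rw [sl2X_mul_sl2Y, sl2X_mat]
  ext i j
  fin_cases i <;> fin_cases j <;> simp

theorem sl2_pow_mul_sl2Y (k : ℕ) :
    (sl2Y.mat * sl2X.mat) ^ k * sl2Y.mat = (1 / 2 : ℝ) ^ k • sl2Y.mat := by
  apply pow_mul_eq_smul
  rw [sl2Y_mul_sl2X, sl2Y_mat]
  ext i j
  fin_cases i <;> fin_cases j <;> simp

/-! ### The BCH series in `sl₂` -/

section BchSl2

variable (t : ℝ)

/-- The coefficient of degree `2k + 1` in `BCH(tX̂, tŶ)`; that of degree `2k + 2` is `t` times it. -/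
def sl2Coeff (k : ℕ) : ℝ := (-1) ^ k * (kappa k * (1 / 2) ^ k * t ^ (2 * k + 1))

theorem sl2_bchTerm_odd (k : ℕ) : bchTerm (2 * k + 1) (t • sl2X.mat) (t • sl2Y.mat) =
    (sl2Coeff t k • Sl2.S 0 (1 / 2) (1 / 2)).mat := by
  rw [bchTerm_smul_odd t sl2X_mul_sl2X sl2Y_mul_sl2Y, sl2_pow_mul_sl2X, sl2_pow_mul_sl2Y,
    ← smul_add, smul_smul, map_smul,
    show Sl2.S 0 (1 / 2) (1 / 2) = sl2X + sl2Y from Sl2.mat_injective (by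
      rw [map_add, sl2X, sl2Y, Sl2.mat_S, Sl2.mat_S, Sl2.mat_S]; simp), map_add, sl2Coeff]
  congr 1
  ring

theorem sl2_bchTerm_even (k : ℕ) : bchTerm (2 * k + 2) (t • sl2X.mat) (t • sl2Y.mat) =
    ((t * sl2Coeff t k) • Sl2.S (1 / 4) 0 0).mat := by
  rw [bchTerm_smul_even t sl2X_mul_sl2X sl2Y_mul_sl2Y,
    pow_succ (sl2X.mat * sl2Y.mat), ← mul_assoc, sl2_pow_mul_sl2X,
    pow_succ (sl2Y.mat * sl2X.mat), ← mul_assoc, sl2_pow_mul_sl2Y, smul_mul_assoc, smul_mul_assoc,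
    ← smul_sub, smul_smul, map_smul, sl2X_mul_sl2Y, sl2Y_mul_sl2X, Sl2.mat_S, sl2Coeff]
  ext i j
  fin_cases i <;> fin_cases j <;> simp <;> ring

theorem exists_sl2_bchTerm (n : ℕ) :
    ∃ z : Sl2, z.mat = bchTerm n (t • sl2X.mat) (t • sl2Y.mat) := by
  induction n using nat_cases_parity with
  | h0 =>
    refine ⟨0, ?_⟩
    rw [bchTerm_zero (smul_mul_smul_eq_zero t sl2X_mul_sl2X)
      (smul_mul_smul_eq_zero t sl2Y_mul_sl2Y), map_zero]
  | h1 k => exact ⟨_, (sl2_bchTerm_odd t k).symm⟩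
  | h2 k => exact ⟨_, (sl2_bchTerm_even t k).symm⟩

/-- The homogeneous parts of `BCH(tX̂, tŶ)`, as elements of `sl₂`. -/
def bchSl2 (n : ℕ) : Sl2 := (exists_sl2_bchTerm t n).choose

theorem mat_bchSl2 (n : ℕ) : (bchSl2 t n).mat = bchTerm n (t • sl2X.mat) (t • sl2Y.mat) :=
  (exists_sl2_bchTerm t n).choose_spec

theorem bchSl2_zero : bchSl2 t 0 = 0 :=
  Sl2.mat_injective (by
    rw [mat_bchSl2, bchTerm_zero (smul_mul_smul_eq_zero t sl2X_mul_sl2X)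
      (smul_mul_smul_eq_zero t sl2Y_mul_sl2Y), map_zero])

theorem bchSl2_odd (k : ℕ) : bchSl2 t (2 * k + 1) = sl2Coeff t k • Sl2.S 0 (1 / 2) (1 / 2) :=
  Sl2.mat_injective (by rw [mat_bchSl2, sl2_bchTerm_odd])

theorem bchSl2_even (k : ℕ) : bchSl2 t (2 * k + 2) = (t * sl2Coeff t k) • Sl2.S (1 / 4) 0 0 :=
  Sl2.mat_injective (by rw [mat_bchSl2, sl2_bchTerm_even])

theorem mat_bchSl2_odd (k : ℕ) : (bchSl2 t (2 * k + 1)).mat =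
    ((-1) ^ k * kappa k * t ^ (2 * k + 1) * (1 / 2) ^ k) • !![0, √2 / 2; √2 / 2, 0] := by
  rw [bchSl2_odd, map_smul, Sl2.mat_S, sl2Coeff]
  ext i j
  fin_cases i <;> fin_cases j <;> simp <;> ring

theorem mat_bchSl2_even (k : ℕ) : (bchSl2 t (2 * k + 2)).mat =
    ((-1) ^ k * kappa k * t ^ (2 * k + 2) * (1 / 2) ^ k) • !![1 / 4, 0; 0, -(1 / 4)] := by
  rw [bchSl2_even, map_smul, Sl2.mat_S, sl2Coeff]
  ext i j
  fin_cases i <;> fin_cases j <;> simp <;> ring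

variable {t}

theorem hasSum_bchSl2 (ht : |t| < 2 * √2) : HasSum (bchSl2 t) (sl2Log t) := by
  have h := hasSum_kappa_arsinh ht
  set C := 8 * Real.arsinh (t / (2 * √2)) / √(8 + t ^ 2) with hC
  have h1 : HasSum (fun k => bchSl2 t (2 * k + 1)) (C • Sl2.S 0 (1 / 2) (1 / 2)) := by
    simp only [bchSl2_odd]
    exact h.smul_const _
  have h2 : HasSum (fun k => bchSl2 t (2 * k + 2)) ((t * C) • Sl2.S (1 / 4) 0 0) := by
    simp only [bchSl2_even]
    exact (h.mul_left t).smul_const _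
  have h3 : HasSum (fun k => bchSl2 t (2 * k)) ((t * C) • Sl2.S (1 / 4) 0 0) := by
    rw [← hasSum_nat_add_iff' 1]
    simpa [bchSl2_zero, mul_add] using h2
  have h4 := h3.even_add_odd h1
  have e : sl2Log t = (t * C) • Sl2.S (1 / 4) 0 0 + C • Sl2.S 0 (1 / 2) (1 / 2) := by
    apply Sl2.mat_injective
    rw [sl2Log, map_smul, map_add, map_smul, map_smul, Sl2.mat_S, Sl2.mat_S, Sl2.mat_S,
      show 2 * Real.arsinh (t / (2 * √2)) / √(8 + t ^ 2) = C / 4 by rw [hC]; ring]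
    ext i j
    fin_cases i <;> fin_cases j <;> simp <;> ring
  rwa [e]

theorem norm_bchSl2_odd (k : ℕ) : ‖bchSl2 t (2 * k + 1)‖ =
    (kappa k * (1 / 2) ^ k * t ^ (2 * k)) * (|t| * ‖Sl2.S 0 (1 / 2) (1 / 2)‖) := by
  rw [bchSl2_odd, norm_smul, sl2Coeff, norm_mul, norm_pow, norm_neg, norm_one, one_pow, one_mul,
    pow_succ, Real.norm_eq_abs, abs_mul, abs_mul, abs_of_pos (kappa_pos k), abs_mul,
    abs_of_nonneg (Even.pow_nonneg (even_two_mul k) t), abs_of_pos (by positivity)]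
  ring

theorem sl2_norm_pos (ht : 8 ≤ t ^ 2) : 0 < |t| * ‖Sl2.S 0 (1 / 2) (1 / 2)‖ := by
  have h0 : t ≠ 0 := by
    rintro rfl
    norm_num at ht
  have : 0 < |t| := abs_pos.2 h0
  rw [Sl2.norm_S]
  positivity

theorem not_summable_norm_bchSl2 (ht : 2 * √2 ≤ |t|) : ¬ Summable fun n => ‖bchSl2 t n‖ := by
  intro h
  have h1 := h.comp_injective (i := fun k : ℕ => 2 * k + 1) (fun a b hab => by simpa using hab)
  have h8 := eight_le_sq ht
  refine not_summable_kappa h8 ((summable_mul_right_iff (sl2_norm_pos h8).ne').1 ?_)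
  exact h1.congr fun k => norm_bchSl2_odd k

/-- Beyond `2√2`, the terms of the series do not even tend to zero, by Bernoulli's inequality. -/
theorem not_tendsto_sum_bchSl2 (ht : 2 * √2 < |t|) :
    ¬ ∃ s : Sl2, Tendsto (fun N => ∑ n ∈ range N, bchSl2 t n) atTop (𝓝 s) := by
  rintro ⟨s, hs⟩
  have h8 := eight_lt_sq ht
  have hpos := sl2_norm_pos h8.le
  set r := t ^ 2 / 8 with hr
  have hr1 : 1 < r := by rw [hr]; linarith
  -- With this `m`, Bernoulli gives `rᵏ ≥ 1 + k (r - 1) ≥ m (2k + 1)`.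
  set m := min 1 ((r - 1) / 2) with hm
  have hm0 : 0 < m := lt_min one_pos (by linarith)
  have hlow : ∀ k : ℕ, m ≤ kappa k * (1 / 2) ^ k * t ^ (2 * k) := by
    intro k
    rw [kappa_mul_half_pow_mul_pow, ← hr]
    have h1 := one_add_mul_le_pow (a := r - 1) (by linarith) k
    rw [add_sub_cancel] at h1
    have h2 := one_le_mul_kappaFour k
    have h3 := kappaFour_pos k
    have hk : (0 : ℝ) ≤ k := by positivity
    have h4 : m * (2 * k + 1) ≤ r ^ k := by
      refine le_trans ?_ h1
      have := min_le_left 1 ((r - 1) / 2)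
      have := min_le_right 1 ((r - 1) / 2)
      nlinarith
    calc m = m * 1 := (mul_one m).symm
      _ ≤ m * ((2 * k + 1) * kappaFour k) := by gcongr
      _ = kappaFour k * (m * (2 * k + 1)) := by ring
      _ ≤ kappaFour k * r ^ k := by gcongr
  have h0 : Tendsto (fun n => bchSl2 t n) atTop (𝓝 0) := by
    have h := ((tendsto_add_atTop_iff_nat 1).2 hs).sub hs
    simpa [sum_range_succ] using h
  have h1 : Tendsto (fun k : ℕ => ‖bchSl2 t (2 * k + 1)‖) atTop (𝓝 0) := by
    have h2 : Tendsto (fun k : ℕ => 2 * k + 1) atTop atTop :=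
      tendsto_atTop_mono (fun k => show k ≤ 2 * k + 1 by omega) tendsto_id
    simpa using (h0.comp h2).norm
  have h2 : m * (|t| * ‖Sl2.S 0 (1 / 2) (1 / 2)‖) ≤ 0 := by
    refine ge_of_tendsto' h1 fun k => ?_
    rw [norm_bchSl2_odd]
    exact mul_le_mul_of_nonneg_right (hlow k) hpos.le
  exact absurd h2 (not_le.2 (mul_pos hm0 hpos))

end BchSl2

/-! ### Matrix exponentials -/

theorem exp_of_mul_self_eq_zero {N : Matrix (Fin 2) (Fin 2) ℝ} (h : N * N = 0) :
    NormedSpace.exp N = 1 + N := by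
  rw [NormedSpace.exp_eq_tsum ℝ]
  change ∑' n : ℕ, ((n.factorial : ℝ)⁻¹) • N ^ n = _
  rw [tsum_eq_sum (s := range 2), sum_range_succ, sum_range_one]
  · simp
  · intro n hn
    obtain ⟨k, rfl⟩ := Nat.exists_eq_add_of_le (show 2 ≤ n by rwa [mem_range, not_lt] at hn)
    rw [pow_add, pow_two, h, zero_mul, smul_zero]

/-- The exponential of a multiple of an involution. -/
theorem exp_smul_of_mul_self_eq_one {J : Matrix (Fin 2) (Fin 2) ℝ} (h : J * J = 1) (w : ℝ) :
    NormedSpace.exp (w • J) = Real.cosh w • (1 : Matrix (Fin 2) (Fin 2) ℝ) + Real.sinh w • J := by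
  rw [NormedSpace.exp_eq_tsum ℝ]
  change ∑' n : ℕ, ((n.factorial : ℝ)⁻¹) • (w • J) ^ n = _
  have he : ∀ k, J ^ (2 * k) = 1 := fun k => by rw [pow_mul, pow_two, h, one_pow]
  refine (HasSum.even_add_odd ?_ ?_).tsum_eq
  · have h1 : HasSum (fun n : ℕ => (w ^ (2 * n) / ((2 * n).factorial : ℝ)) •
        (1 : Matrix (Fin 2) (Fin 2) ℝ)) (Real.cosh w • 1) := (Real.hasSum_cosh w).smul_const _
    refine h1.congr_fun fun k => ?_
    rw [smul_pow, he, smul_smul]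
    congr 1
    ring
  · have h1 : HasSum (fun n : ℕ => (w ^ (2 * n + 1) / ((2 * n + 1).factorial : ℝ)) • J)
        (Real.sinh w • J) := (Real.hasSum_sinh w).smul_const _
    refine h1.congr_fun fun k => ?_
    rw [smul_pow, pow_succ J, he, one_mul, smul_smul]
    congr 1
    ring

/-- With `t = 2√2 sinh a`, the matrix `L(t)` is `2a` times an involution. -/
theorem exp_sl2Log (t : ℝ) : NormedSpace.exp (sl2Log t).mat =
    NormedSpace.exp (t • sl2X.mat) * NormedSpace.exp (t • sl2Y.mat) := by
  set a := Real.arsinh (t / (2 * √2)) with ha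
  set s := √(8 + t ^ 2) with hs
  have hs0 : 0 < s := Real.sqrt_pos.2 (by positivity)
  have hs2 : s ^ 2 = 8 + t ^ 2 := Real.sq_sqrt (by positivity)
  have h2 := sqrt_two_mul_self
  have h20 : (0 : ℝ) < √2 := by positivity
  set J : Matrix (Fin 2) (Fin 2) ℝ := (1 / s) • !![t, √2 * 2; √2 * 2, -t] with hJ
  have hJ2 : J * J = 1 := by
    rw [hJ, smul_mul_smul_comm, Matrix.mul_fin_two, Matrix.one_fin_two]
    have e : 1 / s * (1 / s) = 1 / (8 + t ^ 2) := by rw [← hs2]; field_simp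
    have e1 : t * t + √2 * 2 * (√2 * 2) = 8 + t ^ 2 := by linear_combination 4 * h2
    have e2 : √2 * 2 * (√2 * 2) + -t * -t = 8 + t ^ 2 := by linear_combination 4 * h2
    have hne : 8 + t ^ 2 ≠ 0 := by positivity
    rw [e, e1, e2]
    ext i j
    fin_cases i <;> fin_cases j <;> simp [hne]
    · ring
    · ring
  have hL : (sl2Log t).mat = (2 * a) • J := by
    rw [sl2Log, map_smul, Sl2.mat_S, hJ, smul_smul]
    congr 1
    ring
  have hsinh : Real.sinh a = t / (2 * √2) := Real.sinh_arsinh _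
  have hcosh : Real.cosh a = s / (2 * √2) := by
    rw [ha, Real.cosh_arsinh, sqrt_one_add_div_sq]
  have hc2 : Real.cosh (2 * a) = 1 + t ^ 2 / 4 := by
    rw [Real.cosh_two_mul, hsinh, hcosh, div_pow, div_pow, two_sqrt_two_sq, hs2]
    ring
  have hs2a : Real.sinh (2 * a) = t * s / 4 := by
    rw [Real.sinh_two_mul, hsinh, hcosh, mul_assoc, div_mul_div_comm, ← pow_two, two_sqrt_two_sq]
    ring
  rw [hL, exp_smul_of_mul_self_eq_one hJ2, hc2, hs2a,
    exp_of_mul_self_eq_zero (smul_mul_smul_eq_zero t sl2X_mul_sl2X),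
    exp_of_mul_self_eq_zero (smul_mul_smul_eq_zero t sl2Y_mul_sl2Y), hJ, smul_smul,
    show t * s / 4 * (1 / s) = t / 4 by field_simp, add_mul, mul_add, mul_add, mul_one, one_mul,
    smul_mul_smul_comm, sl2X_mul_sl2Y, sl2X_mat, sl2Y_mat]
  ext i j
  fin_cases i <;> fin_cases j <;> simp <;> ring

/-! ### Lie monomials and the `ℓ¹` norm -/

theorem lieMonomial_map {α L L' : Type*} [LieRing L] [LieRing L'] (f : L → L')
    (hf : ∀ a b, f ⁅a, b⁆ = ⁅f a, f b⁆) (v : α → L) (γ : FreeMagma α) :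
    f (lieMonomial v γ) = lieMonomial (f ∘ v) γ := by
  induction γ with
  | ih1 i => rfl
  | ih2 γ δ h1 h2 =>
    change f ⁅lieMonomial v γ, lieMonomial v δ⁆ = ⁅lieMonomial (f ∘ v) γ, lieMonomial (f ∘ v) δ⁆
    rw [hf, h1, h2]

/-- Values of Lie polynomials commute with linear maps that preserve brackets. -/
theorem sum_lieMonomial_map {α L L' : Type*} [LieRing L] [LieRing L'] [Module ℝ L] [Module ℝ L']
    (f : L →ₗ[ℝ] L') (hf : ∀ a b, f ⁅a, b⁆ = ⁅f a, f b⁆) (v : α → L) (θ : FreeMagma α →₀ ℝ) :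
    f (θ.sum fun γ c => c • lieMonomial v γ) = θ.sum fun γ c => c • lieMonomial (f ∘ v) γ := by
  rw [Finsupp.sum, Finsupp.sum, map_sum]
  refine sum_congr rfl fun γ _ => ?_
  rw [map_smul, lieMonomial_map f hf]

/-- Any presentation of the BCH polynomial by Lie monomials has the expected value at
`(tX, tY)`. -/
theorem sum_lieMonomial_wslEmb {n : ℕ} {θ : FreeMagma (Fin 2) →₀ ℝ}
    (h : θ.sum (fun γ c => c • lieMonomial (FreeAlgebra.ι ℝ) γ) =
      bchTerm n (FreeAlgebra.ι ℝ (0 : Fin 2)) (FreeAlgebra.ι ℝ (1 : Fin 2))) (t : ℝ) :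
    θ.sum (fun γ c => c • lieMonomial ![t • wslEmb wslX, t • wslEmb wslY] γ) =
      wslEmb (bchWsl t n) := by
  let φ : FreeAlgebra ℝ (Fin 2) →ₐ[ℝ] SqZeroAlg := FreeAlgebra.lift ℝ ![t • genX, t • genY]
  have hφ0 : φ (FreeAlgebra.ι ℝ 0) = t • genX := by
    rw [FreeAlgebra.lift_ι_apply]; rfl
  have hφ1 : φ (FreeAlgebra.ι ℝ 1) = t • genY := by
    rw [FreeAlgebra.lift_ι_apply]; rfl
  have h1 := congrArg φ h
  rw [← bchTerm_map, hφ0, hφ1] at h1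
  have h2 := sum_lieMonomial_map φ.toLinearMap (fun a b => (AlgHom.toLieHom φ).map_lie a b)
    (FreeAlgebra.ι ℝ) θ
  have h3 := sum_lieMonomial_map wslAlg.incl.toLinearMap (fun a b => wslAlg.incl.map_lie a b)
    ![t • wslX, t • wslY] θ
  have h4 := sum_lieMonomial_map wslEmb.toLinearMap (fun a b => wslEmb.map_lie a b)
    ![t • wslX, t • wslY] θ
  have hv : φ.toLinearMap ∘ FreeAlgebra.ι ℝ = wslAlg.incl.toLinearMap ∘ ![t • wslX, t • wslY] := by
    funext i
    fin_cases i
    · exact hφ0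
    · exact hφ1
  have hw : wslEmb.toLinearMap ∘ ![t • wslX, t • wslY] =
      ![t • wslEmb wslX, t • wslEmb wslY] := by
    funext i
    fin_cases i
    · exact map_smul wslEmb t wslX
    · exact map_smul wslEmb t wslY
  rw [hv, ← h3] at h2
  rw [hw] at h4
  rw [← h4]
  refine congrArg wslEmb (Subtype.ext ?_)
  exact h2.symm.trans h1

theorem norm_lieMonomial_le_one {α : Type*} {v : α → Wsl} (hv : ∀ i, ‖v i‖ ≤ 1) (γ : FreeMagma α) :
    ‖lieMonomial v γ‖ ≤ 1 := by
  induction γ with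
  | ih1 i => exact hv i
  | ih2 γ δ h1 h2 => exact (Wsl.norm_lie_le _ _).trans (mul_le_one₀ h1 (norm_nonneg _) h2)

theorem norm_wslEmb_wslX : ‖wslEmb wslX‖ = 1 := by
  rw [norm_eq_of_coords (coords_wslEmb_oddX (a := wslX) (n := 0) oddX_zero.symm), wNorm_X_pow,
    wNorm_zero]
  norm_num

theorem norm_wslEmb_wslY : ‖wslEmb wslY‖ = 1 := by
  rw [norm_eq_of_coords (coords_wslEmb_oddY (a := wslY) (n := 0) oddY_zero.symm), wNorm_X_pow,
    wNorm_zero]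
  norm_num

/-- As `X` and `Y` have norm one in a Banach–Lie algebra, evaluation at `(X, Y)` does not increase
norms. -/
theorem ofReal_norm_bchWsl_le (n : ℕ) : ENNReal.ofReal ‖wslEmb (bchWsl 1 n)‖ ≤
    lieL1Norm (bchTerm n (FreeAlgebra.ι ℝ (0 : Fin 2)) (FreeAlgebra.ι ℝ (1 : Fin 2))) := by
  refine le_iInf₂ fun θ hθ => ENNReal.ofReal_le_ofReal ?_
  rw [← sum_lieMonomial_wslEmb hθ 1, Finsupp.sum, Finsupp.sum]
  refine (norm_sum_le _ _).trans (sum_le_sum fun γ _ => ?_)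
  rw [norm_smul, Real.norm_eq_abs]
  refine mul_le_of_le_one_right (abs_nonneg _) (norm_lieMonomial_le_one ?_ γ)
  intro i
  fin_cases i
  · change ‖(1 : ℝ) • wslEmb wslX‖ ≤ 1
    rw [one_smul, norm_wslEmb_wslX]
  · change ‖(1 : ℝ) • wslEmb wslY‖ ≤ 1
    rw [one_smul, norm_wslEmb_wslY]

theorem lieL1Norm_zero : lieL1Norm 0 = 0 :=
  nonpos_iff_eq_zero.1 (iInf₂_le_of_le 0 Finsupp.sum_zero_index (by simp))

theorem lieL1Norm_add_le (P Q : FreeAlgebra ℝ (Fin 2)) :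
    lieL1Norm (P + Q) ≤ lieL1Norm P + lieL1Norm Q := by
  classical
  rw [lieL1Norm, lieL1Norm, lieL1Norm]
  simp only [ENNReal.iInf_add, ENNReal.add_iInf]
  refine le_iInf₂ fun η hη => le_iInf₂ fun θ hθ => iInf₂_le_of_le (θ + η) ?_ ?_
  · rw [Finsupp.sum_add_index' (fun γ => by rw [zero_smul]) (fun γ b c => add_smul b c _), hθ, hη]
  · have h0 : ∀ γ ∈ θ.support ∪ η.support, |(0 : ℝ)| = 0 := fun _ _ => abs_zero
    have hs1 : θ.support ⊆ θ.support ∪ η.support := subset_union_left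
    have hs2 : η.support ⊆ θ.support ∪ η.support := subset_union_right
    have hn : ∀ ζ : FreeMagma (Fin 2) →₀ ℝ, 0 ≤ ζ.sum fun _ c => |c| := fun ζ =>
      sum_nonneg fun _ _ => abs_nonneg _
    rw [← ENNReal.ofReal_add (hn _) (hn _)]
    refine ENNReal.ofReal_le_ofReal ?_
    rw [Finsupp.sum_of_support_subset _ Finsupp.support_add _ h0,
      Finsupp.sum_of_support_subset _ hs1 _ h0, Finsupp.sum_of_support_subset _ hs2 _ h0,
      ← sum_add_distrib]
    exact sum_le_sum fun γ _ => abs_add_le _ _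

/-- The sum over bihomogeneous parts dominates the `ℓ¹` norm of the homogeneous part. -/
theorem lieL1Norm_bchTerm_le (n : ℕ) :
    lieL1Norm (bchTerm n (FreeAlgebra.ι ℝ (0 : Fin 2)) (FreeAlgebra.ι ℝ (1 : Fin 2))) ≤
      ∑ pq ∈ antidiagonal n, gammaCoeff pq.1 pq.2 :=
  le_sum_of_subadditive lieL1Norm lieL1Norm_zero.le lieL1Norm_add_le _ _

theorem ofReal_le_sum_gammaCoeff_odd (k : ℕ) : ENNReal.ofReal (kappa k * (2 * (1 / 2) ^ k)) ≤
    ∑ pq ∈ antidiagonal (2 * k + 1), gammaCoeff pq.1 pq.2 := by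
  refine le_trans (le_of_eq ?_) ((ofReal_norm_bchWsl_le _).trans (lieL1Norm_bchTerm_le _))
  rw [norm_wslEmb_bchWsl_odd, abs_one, one_pow]
  congr 1
  ring

theorem ofReal_le_sum_gammaCoeff_even (k : ℕ) : ENNReal.ofReal (kappa k * (1 / 2) ^ (k + 1)) ≤
    ∑ pq ∈ antidiagonal (2 * k + 2), gammaCoeff pq.1 pq.2 := by
  refine le_trans (le_of_eq ?_) ((ofReal_norm_bchWsl_le _).trans (lieL1Norm_bchTerm_le _))
  rw [norm_wslEmb_bchWsl_even, one_pow, one_pow]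
  congr 1
  ring

/-! ### Divergence of `Γ^Lie` and the convergence radii -/

theorem gammaLie_self (x : ℝ≥0) : gammaLie x x =
    ∑' n : ℕ, (∑ pq ∈ antidiagonal n, gammaCoeff pq.1 pq.2) * (x : ℝ≥0∞) ^ n := by
  rw [gammaLie, ← ENNReal.tsum_prod
    (f := fun p q => gammaCoeff p q * (x : ℝ≥0∞) ^ p * (x : ℝ≥0∞) ^ q),
    ← Finset.HasAntidiagonal.sigmaAntidiagonalEquivProd.tsum_eq, ENNReal.tsum_sigma']
  refine tsum_congr fun n => ?_
  rw [tsum_fintype, univ_eq_attach, sum_mul, ← sum_attach (antidiagonal n)]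
  refine sum_congr rfl fun pq _ => ?_
  have h := HasAntidiagonal.mem_antidiagonal.1 pq.2
  change gammaCoeff pq.1.1 pq.1.2 * (x : ℝ≥0∞) ^ pq.1.1 * (x : ℝ≥0∞) ^ pq.1.2 = _
  rw [mul_assoc, ← pow_add, h]

theorem gammaLie_self_eq_top {x : ℝ≥0} (hx : 8 ≤ (x : ℝ) ^ 2) : gammaLie x x = ∞ := by
  by_contra hne
  have h1 : ∑' k : ℕ, ENNReal.ofReal (kappa k * (2 * (1 / 2) ^ k) * (x : ℝ) ^ (2 * k + 1)) ≠ ∞ := by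
    refine ne_top_of_le_ne_top hne ?_
    rw [gammaLie_self]
    refine le_trans (ENNReal.tsum_le_tsum fun k => ?_)
      (ENNReal.tsum_comp_le_tsum_of_injective (f := fun k : ℕ => 2 * k + 1)
        (fun a b hab => by simpa using hab) _)
    rw [ENNReal.ofReal_mul (by have := kappa_pos k; positivity), ENNReal.ofReal_pow x.coe_nonneg,
      ENNReal.ofReal_coe_nnreal]
    gcongr
    exact ofReal_le_sum_gammaCoeff_odd k
  have h2 := ENNReal.summable_toReal h1
  have hx0 : (x : ℝ) ≠ 0 := by
    intro h0
    rw [h0] at hx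
    norm_num at hx
  refine not_summable_kappa hx ((h2.mul_left (2 * (x : ℝ))⁻¹).congr fun k => ?_)
  rw [ENNReal.toReal_ofReal (by have := kappa_pos k; positivity), pow_succ]
  field_simp

theorem cumulativeRadius_le_diagonalRadius : cumulativeRadius ≤ diagonalRadius := by
  refine iSup₂_le fun x hx => ?_
  have h : gammaLie (x / 2) (x / 2) < ∞ := by
    refine lt_of_le_of_lt ?_ hx
    exact le_iSup_of_le (x / 2) (le_iSup_of_le (x / 2) (le_iSup_of_le (add_halves x).le le_rfl))
  exact le_iSup₂_of_le x h le_rfl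

theorem diagonalRadius_le : diagonalRadius ≤ ((4 * NNReal.sqrt 2 : ℝ≥0) : ℝ≥0∞) := by
  refine iSup₂_le fun x hx => ?_
  rw [ENNReal.coe_le_coe]
  by_contra hlt
  rw [not_le] at hlt
  refine hx.ne (gammaLie_self_eq_top ?_)
  have h1 : 4 * √2 < (x : ℝ) := by
    have := NNReal.coe_lt_coe.2 hlt
    simpa using this
  have h2 : 2 * √2 ≤ |((x / 2 : ℝ≥0) : ℝ)| := by
    rw [NNReal.coe_div, NNReal.coe_two, abs_of_nonneg (by positivity)]
    linarith
  exact eight_le_sq h2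

theorem gammaLie_two_sqrt_two : gammaLie (2 * NNReal.sqrt 2) (2 * NNReal.sqrt 2) = ∞ :=
  gammaLie_self_eq_top (by simp [← two_sqrt_two_sq])

/-! ### The minorant `Ξ` -/

theorem xi_term_eq (k : ℕ) (t : ℝ) :
    kappa k * (t ^ (2 * k + 1) * (2 * (1 / 2) ^ k) + t ^ (2 * k + 2) * (1 / 2) ^ (k + 1)) =
      (2 + t / 2) * (kappa k * (1 / 2) ^ k * t ^ (2 * k + 1)) := by
  ring

theorem hasSum_xi {t : ℝ} (h0 : 0 ≤ t) (ht : t < 2 * √2) : HasSum (fun k : ℕ => kappa k *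
      (t ^ (2 * k + 1) * (2 * (1 / 2) ^ k) + t ^ (2 * k + 2) * (1 / 2) ^ (k + 1)))
    (4 * Real.arcsin (t / (2 * √2)) / √(8 - t ^ 2) * (4 + t)) := by
  simp only [xi_term_eq]
  have h := (hasSum_kappa_arcsin (by rwa [abs_of_nonneg h0])).mul_left (2 + t / 2)
  rwa [show (2 + t / 2) * (8 * Real.arcsin (t / (2 * √2)) / √(8 - t ^ 2)) =
    4 * Real.arcsin (t / (2 * √2)) / √(8 - t ^ 2) * (4 + t) by ring] at h

theorem not_summable_xi {t : ℝ} (ht : 2 * √2 ≤ t) : ¬ Summable fun k : ℕ => kappa k *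
    (t ^ (2 * k + 1) * (2 * (1 / 2) ^ k) + t ^ (2 * k + 2) * (1 / 2) ^ (k + 1)) := by
  have ht0 : 0 < t := lt_of_lt_of_le (by positivity) ht
  intro h
  refine not_summable_kappa (eight_le_sq (ht.trans (le_abs_self t)))
    ((summable_mul_left_iff (a := (2 + t / 2) * t) (by positivity)).1 (h.congr fun k => ?_))
  ring

end LieBCH

end

theorem mainTheorem2 :
    -- the elements `X^{(2n+1)}`, `Y^{(2m+1)}`, `XY^{(2k)}` form a linear basis of `wsl₂^alg`
    LinearIndependent ℝ wslVec ∧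
    Submodule.span ℝ (Set.range wslVec) = wslAlg.toSubmodule ∧
    -- the commutation rules
    (∀ n m : ℕ, ⁅oddX n, oddY m⁆ = evenXY (n + m + 1)) ∧
    (∀ k n : ℕ, 1 ≤ k → ⁅evenXY k, oddX n⁆ = (2 : ℝ) • oddX (k + n)) ∧
    (∀ m k : ℕ, 1 ≤ k → ⁅oddY m, evenXY k⁆ = (2 : ℝ) • oddY (k + m)) ∧
    (∀ n n' : ℕ, ⁅oddX n, oddX n'⁆ = 0) ∧
    (∀ m m' : ℕ, ⁅oddY m, oddY m'⁆ = 0) ∧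
    (∀ k k' : ℕ, 1 ≤ k → 1 ≤ k' → ⁅evenXY k, evenXY k'⁆ = 0) ∧
    -- `wsl₂¹` is a Banach–Lie algebra
    CompleteSpace Wsl ∧
    (∀ z w : Wsl, ‖⁅z, w⁆‖ ≤ ‖z‖ * ‖w‖) ∧
    -- it is the completion of `wsl₂^alg` for the weighted `ℓ¹` norm
    (∃ ι : wslAlg →ₗ⁅ℝ⁆ Wsl,
      Function.Injective ι ∧ DenseRange ι ∧
      (∀ (a : wslAlg) (n : ℕ), (a : SqZeroAlg) = oddX n →
        (ι a).coords = (PowerSeries.X ^ n, 0, 0) ∧ ‖ι a‖ = (1 / 2) ^ n) ∧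
      (∀ (a : wslAlg) (m : ℕ), (a : SqZeroAlg) = oddY m →
        (ι a).coords = (0, PowerSeries.X ^ m, 0) ∧ ‖ι a‖ = (1 / 2) ^ m) ∧
      (∀ (a : wslAlg) (k : ℕ), (a : SqZeroAlg) = evenXY (k + 1) →
        (ι a).coords = (0, 0, PowerSeries.X ^ k) ∧ ‖ι a‖ = (1 / 2) ^ k) ∧
      ‖ι wslX‖ = 1 ∧ ‖ι wslY‖ = 1 ∧
      -- the homogeneous parts of `BCH(tX, tY)`, in closed form
      (∀ t : ℝ, ∃ β : ℕ → wslAlg,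
        (∀ n : ℕ, (β n : SqZeroAlg) = bchTerm n (t • genX) (t • genY)) ∧
        (∀ (n : ℕ) (θ : FreeMagma (Fin 2) →₀ ℝ),
          θ.sum (fun γ c => c • lieMonomial (FreeAlgebra.ι ℝ) γ) =
            bchTerm n (FreeAlgebra.ι ℝ (0 : Fin 2)) (FreeAlgebra.ι ℝ (1 : Fin 2)) →
          θ.sum (fun γ c => c • lieMonomial ![t • ι wslX, t • ι wslY] γ) = ι (β n)) ∧
        β 0 = 0 ∧
        (∀ k : ℕ, (β (2 * k + 1) : SqZeroAlg) =
          ((-1) ^ k * kappa k * t ^ (2 * k + 1)) • (oddX k + oddY k)) ∧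
        (∀ k : ℕ, (β (2 * k + 2) : SqZeroAlg) =
          ((-1) ^ k * kappa k * t ^ (2 * k + 2) * (1 / 2)) • evenXY (k + 1)) ∧
        -- convergence, and divergence from `2√2` on
        (|t| < 2 * √2 → Summable fun n => ‖ι (β n)‖) ∧
        (2 * √2 ≤ |t| →
          ¬ ∃ s : Wsl, Tendsto (fun N => ∑ n ∈ Finset.range N, ι (β n)) atTop (𝓝 s)))) ∧
    -- no logarithm of `exp(2√2 X) exp(2√2 Y)` exists in `wsl₂¹`
    (¬ ∃ z : Wsl, formalExp z.toFormal =
      formalExp (PowerSeries.monomial 1 ((2 * √2 : ℝ) • genX)) *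
        formalExp (PowerSeries.monomial 1 ((2 * √2 : ℝ) • genY))) ∧
    -- the Banach–Lie algebra `sl₂` and the homomorphism `X ↦ X̂`, `Y ↦ Ŷ`
    CompleteSpace Sl2 ∧
    (∀ z w : Sl2, ‖⁅z, w⁆‖ ≤ ‖z‖ * ‖w‖) ∧
    (∀ a b c : ℝ, ‖Sl2.S a b c‖ = 2 * √(a ^ 2 + b ^ 2 + c ^ 2)) ∧
    sl2X.mat = !![0, √2 / 2; 0, 0] ∧ sl2Y.mat = !![0, 0; √2 / 2, 0] ∧
    ‖sl2X‖ = 1 ∧ ‖sl2Y‖ = 1 ∧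
    (∃ φ : SqZeroAlg →ₐ[ℝ] Matrix (Fin 2) (Fin 2) ℝ, φ genX = sl2X.mat ∧ φ genY = sl2Y.mat) ∧
    -- the homogeneous parts of `BCH(tX̂, tŶ)`, in closed form
    (∀ t : ℝ, ∃ β : ℕ → Sl2,
      (∀ n : ℕ, (β n).mat = bchTerm n (t • sl2X.mat) (t • sl2Y.mat)) ∧
      β 0 = 0 ∧
      (∀ k : ℕ, (β (2 * k + 1)).mat =
        ((-1) ^ k * kappa k * t ^ (2 * k + 1) * (1 / 2) ^ k) • !![0, √2 / 2; √2 / 2, 0]) ∧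
      (∀ k : ℕ, (β (2 * k + 2)).mat =
        ((-1) ^ k * kappa k * t ^ (2 * k + 2) * (1 / 2) ^ k) • !![1 / 4, 0; 0, -(1 / 4)]) ∧
      (|t| < 2 * √2 → HasSum β (sl2Log t)) ∧
      (2 * √2 ≤ |t| → ¬ Summable fun n => ‖β n‖) ∧
      (2 * √2 < |t| →
        ¬ ∃ s : Sl2, Tendsto (fun N => ∑ n ∈ Finset.range N, β n) atTop (𝓝 s))) ∧
    -- the closed form is a logarithm for every real `t`
    (∀ t : ℝ, NormedSpace.exp (sl2Log t).mat =
      NormedSpace.exp (t • sl2X.mat) * NormedSpace.exp (t • sl2Y.mat)) ∧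
    -- the coefficientwise estimate of `Γ^Lie(t, t)` from below by `Ξ(t)`
    (∀ k : ℕ, ENNReal.ofReal (kappa k * (2 * (1 / 2) ^ k)) ≤
      ∑ pq ∈ Finset.HasAntidiagonal.antidiagonal (2 * k + 1), gammaCoeff pq.1 pq.2) ∧
    (∀ k : ℕ, ENNReal.ofReal (kappa k * (1 / 2) ^ (k + 1)) ≤
      ∑ pq ∈ Finset.HasAntidiagonal.antidiagonal (2 * k + 2), gammaCoeff pq.1 pq.2) ∧
    -- the value of `Ξ(t)`
    (∀ t : ℝ, 0 ≤ t → t < 2 * √2 →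
      HasSum (fun k : ℕ => kappa k *
          (t ^ (2 * k + 1) * (2 * (1 / 2) ^ k) + t ^ (2 * k + 2) * (1 / 2) ^ (k + 1)))
        (4 * Real.arcsin (t / (2 * √2)) / √(8 - t ^ 2) * (4 + t))) ∧
    (∀ t : ℝ, 2 * √2 ≤ t →
      ¬ Summable fun k : ℕ => kappa k *
        (t ^ (2 * k + 1) * (2 * (1 / 2) ^ k) + t ^ (2 * k + 2) * (1 / 2) ^ (k + 1))) ∧
    -- the corollary
    gammaLie (2 * NNReal.sqrt 2) (2 * NNReal.sqrt 2) = ∞ ∧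
    cumulativeRadius ≤ diagonalRadius ∧
    diagonalRadius ≤ ((4 * NNReal.sqrt 2 : ℝ≥0) : ℝ≥0∞) := by
  refine ⟨linearIndependent_wslVec, span_wslVec, lie_oddX_oddY, ?_, ?_, lie_oddX_oddX,
    lie_oddY_oddY, ?_, inferInstance, Wsl.norm_lie_le, ?_, not_exists_log two_sqrt_two_sq.ge,
    inferInstance, Sl2.norm_lie_le, Sl2.norm_S, sl2X_mat, sl2Y_mat, norm_sl2X, norm_sl2Y,
    ⟨sqZeroLift _ _ sl2X_mul_sl2X sl2Y_mul_sl2Y, sqZeroLift_genX _ _ _ _, sqZeroLift_genY _ _ _ _⟩,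
    fun t => ⟨bchSl2 t, mat_bchSl2 t, bchSl2_zero t, mat_bchSl2_odd t, mat_bchSl2_even t,
      hasSum_bchSl2, not_summable_norm_bchSl2, not_tendsto_sum_bchSl2⟩,
    exp_sl2Log, ofReal_le_sum_gammaCoeff_odd, ofReal_le_sum_gammaCoeff_even,
    fun _ => hasSum_xi, fun _ => not_summable_xi, gammaLie_two_sqrt_two,
    cumulativeRadius_le_diagonalRadius, diagonalRadius_le⟩
  · intro k n hk
    obtain ⟨k, rfl⟩ := Nat.exists_eq_add_of_le' hk
    exact lie_evenXY_oddX k n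
  · intro m k hk
    obtain ⟨k, rfl⟩ := Nat.exists_eq_add_of_le' hk
    exact lie_oddY_evenXY m k
  · intro k k' hk hk'
    obtain ⟨k, rfl⟩ := Nat.exists_eq_add_of_le' hk
    obtain ⟨k', rfl⟩ := Nat.exists_eq_add_of_le' hk'
    exact lie_evenXY_evenXY k k'
  · refine ⟨wslEmb, wslEmb_injective, wslEmb_denseRange,
      fun a n ha => ⟨coords_wslEmb_oddX ha, ?_⟩, fun a m ha => ⟨coords_wslEmb_oddY ha, ?_⟩,
      fun a k ha => ⟨coords_wslEmb_evenXY ha, ?_⟩, norm_wslEmb_wslX, norm_wslEmb_wslY,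
      fun t => ⟨bchWsl t, fun n => rfl, fun n θ hθ => sum_lieMonomial_wslEmb hθ t, bchWsl_zero t,
        bchTerm_gen_odd t, bchTerm_gen_even t, summable_norm_bchWsl, not_tendsto_sum_bchWsl⟩⟩
    · rw [norm_eq_of_coords (coords_wslEmb_oddX ha), wNorm_X_pow, wNorm_zero, add_zero, add_zero]
    · rw [norm_eq_of_coords (coords_wslEmb_oddY ha), wNorm_X_pow, wNorm_zero, zero_add, add_zero]
    · rw [norm_eq_of_coords (coords_wslEmb_evenXY ha), wNorm_X_pow, wNorm_zero, zero_add, zero_add]
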